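/- Let $d\in\{2,3\}$ and $m\ge 0$. Let $\mathcal T_h$ be a mesh of a bounded polygonal/polyhedral domain $\Omega\subset\mathbb R^d$ into finitely many convex polytopes $K$ with nonempty interior (e.g. triangles or tetrahedra), which do not overlap and have no hanging nodes (two distinct elements meet in a, possibly empty, common face of both). Let $\mathcal F_h$ be the set of its $(d-1)$-dimensional faces, $\mathcal F_K$ the set of faces of $K$, and let $h_K,h_F$ be the diameters of $K$ and $F$. On an interior face $F$, shared by $K_+$ and $K_-$, let $n_F$ be the unit normal pointing from $K_+$ to $K_-$, $[\![v]\!]=v_+-v_-$ and $\{\!\{v\}\!\}=\frac12(v_++v_-)$; on a boundary face let $n_F$ be the outward unit normal and $[\![v]\!]=\{\!\{v\}\!\}=v$. Let $\nabla_h$ be the elementwise gradient and write $\tau_h(w)=\nabla_h w+\nabla_h w^T-\frac23(\nabla_h\cdot w)\mathbb I$. Let $W_h$ be a linear subspace of $$H_0(\mathrm{div};\Omega)=\{w\in L^2(\Omega)^d:\ \nabla\cdot w\in L^2(\Omega),\ w\cdot n|_{\partial\Omega}=0\}$$ whose members are polynomial vector fields of degree at most $m$ on every element. For $\eta\in\mathbb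 R$ and $v,w\in W_h$ let $$a_h(v,w)=\sum_{K}\int_K\tau_h(v):\nabla_h w-\sum_{F}\int_F[\![v]\!]\cdot\{\!\{\tau_h(w)\}\!\}n_F-\sum_{F}\int_F[\![w]\!]\cdot\{\!\{\tau_h(v)\}\!\}n_F+\sum_{F}\int_F\frac{\eta}{h_F}[\![v]\!]\cdot[\![w]\!],$$ $$|||w|||_{\rm sym}^2=\|\tau_h(w)\|_{L^2(\Omega)}^2+\sum_{F}\int_F\frac1{h_F}|[\![w]\!]|^2,\qquad |||w|||_{*}^2=|||w|||_{\rm sym}^2+\tfrac49(3-d)\|\nabla_h\cdot w\|_{L^2(\Omega)}^2 .$$ Let $C_{\rm tr}(\mathcal T_h)$ be the best constant in the discrete trace inequality $h_K^{1/2}\|p\|_{L^2(F)}\le C_{\rm tr}\|p\|_{L^2(K)}$ ($K\in\mathcal T_h$, $F\in\mathcal F_K$, $p$ a polynomial of degree at most $m$), and let $N_\partial(\mathcal T_h)$ be the largest number of faces of an element. Then: 1. $C_{\rm tr}(\mathcal T_h)$ is bounded by a number that depends only on $d$, $m$ and $\sigma$ as $\mathcal T_h$ ranges over all meshes each of whose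 elements $K$ contains a ball of some radius $r>0$ with $h_K\le\sigma r$. 2. For all $c$, $N$, $\eta$ with $\eta>2c^2N$ there is a constant $C>0$ such that for every mesh $\mathcal T_h$ with $C_{\rm tr}(\mathcal T_h)\le c$ and $N_\partial(\mathcal T_h)\le N$ and every such $W_h$, $$a_h(w_h,w_h)\ \ge\ C\,|||w_h|||_*^2=C\Big(|||w_h|||_{\rm sym}^2+\tfrac49(3-d)\|\nabla_h\cdot w_h\|_{L^2(\Omega)}^2\Big)\qquad\text{for all }w_h\in W_h.$$ In particular, $C$ is independent of the mesh size. 3. $|||\cdot|||_*$ is a norm on $W_h$; for $d=3$ it coincides with $|||\cdot|||_{\rm sym}$. -/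

import Mathlib

open MeasureTheory Set
open scoped BigOperators ContDiff RealInnerProductSpace

noncomputable section

namespace ViscousDG

/-- Points and vectors of `ℝᵈ`, with the Euclidean norm. -/
abbrev Pt (d : ℕ) := EuclideanSpace ℝ (Fin d)

/-- `K` is a full-dimensional convex polytope: the convex hull of finitely many points, with
nonempty interior (for instance a nondegenerate triangle or tetrahedron). -/
def IsPolytope {d : ℕ} (K : Set (Pt d)) : Prop :=
  (∃ s : Finset (Pt d), K = convexHull ℝ (s : Set (Pt d))) ∧ (interior K).Nonempty

/-- `F` is a facet of `K`: an exposed face of dimension `d - 1` (an edge of a polygon, a polygonal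
face of a polyhedron). -/
def IsFacet {d : ℕ} (K F : Set (Pt d)) : Prop :=
  IsExposed ℝ K F ∧ Module.finrank ℝ (vectorSpan ℝ F) + 1 = d

/-- A conforming mesh of convex polytopes without hanging nodes, together with an orientation of
its faces. -/
structure Mesh (d : ℕ) where
  /-- the elements `K` -/
  elements : Finset (Set (Pt d))
  /-- the faces `F` of the mesh -/
  faces : Finset (Set (Pt d))
  isPolytope : ∀ K ∈ elements, IsPolytope K
  /-- elements do not overlap -/
  disjoint_interior : ∀ K ∈ elements, ∀ K' ∈ elements, K ≠ K' →
    Disjoint (interior K) (interior K')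
  /-- no hanging nodes: two elements meet in a (possibly empty) common face of both -/
  face_to_face : ∀ K ∈ elements, ∀ K' ∈ elements, K ≠ K' →
    IsExposed ℝ K (K ∩ K') ∧ IsExposed ℝ K' (K ∩ K')
  mem_faces : ∀ F, F ∈ faces ↔ ∃ K ∈ elements, IsFacet K F
  /-- a face is shared by at most two elements -/
  two_sided : ∀ F ∈ faces, {K | K ∈ elements ∧ IsFacet K F}.ncard ≤ 2
  /-- the element on the positive side of a face (the only adjacent one for a boundary face) -/
  plus : {F // F ∈ faces} → {K // K ∈ elements}
  plus_facet : ∀ F, IsFacet (plus F).1 F.1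
  /-- the unit normal `n_F` -/
  normal : {F // F ∈ faces} → Pt d
  norm_normal : ∀ F, ‖normal F‖ = 1
  /-- `n_F` points out of the positive side -/
  normal_outward : ∀ F,
    F.1 = {x | x ∈ (plus F).1 ∧ ∀ y ∈ (plus F).1, ⟪normal F, y⟫ ≤ ⟪normal F, x⟫}

/-- A polynomial vector field on `ℝᵈ`. -/
abbrev PolyField (d : ℕ) := Fin d → MvPolynomial (Fin d) ℝ

/-- The value of a polynomial at a point. -/
def evalAt {d : ℕ} (x : Pt d) (p : MvPolynomial (Fin d) ℝ) : ℝ :=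
  MvPolynomial.eval (fun i => x i) p

/-- The gradient `(∇ w)_{ij} = ∂_j w_i`. -/
def grad {d : ℕ} (w : PolyField d) (i j : Fin d) : MvPolynomial (Fin d) ℝ :=
  MvPolynomial.pderiv j (w i)

/-- The divergence `∇ · w`. -/
def divergence {d : ℕ} (w : PolyField d) : MvPolynomial (Fin d) ℝ :=
  ∑ k, MvPolynomial.pderiv k (w k)

/-- The viscous stress `∇ w + ∇ wᵀ - (2/3) (∇ · w) 𝕀`. -/
def stress {d : ℕ} (w : PolyField d) (i j : Fin d) : MvPolynomial (Fin d) ℝ :=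
  grad w i j + grad w j i - if i = j then MvPolynomial.C (2 / 3) * divergence w else 0

namespace Mesh

variable {d : ℕ} (T : Mesh d)

/-- The domain `Ω` covered by the mesh. -/
def domain : Set (Pt d) := interior (⋃ K ∈ T.elements, K)

open Classical in
/-- The elements that have `F` as a face: two for an interior face, one for a boundary face. -/
def adj (F : T.faces) : Finset T.elements :=
  Finset.univ.filter fun K => IsFacet K.1 F.1

/-- Piecewise polynomial vector fields: one polynomial field `w|_K` for each element `K`. -/
abbrev BrokenField := T.elements → PolyField d

open Classical in
/-- The function on `Ω` given (off the element boundaries, a null set) by a piecewise polynomial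
field. -/
def BrokenField.toFun {T : Mesh d} (w : T.BrokenField) (x : Pt d) : Pt d :=
  ∑ K : T.elements, if x ∈ interior K.1 then WithLp.toLp 2 fun i => evalAt x (w K i) else 0

open Classical in
/-- The jump `[[w]]` on a face: `w₊ - w₋` on an interior face, `w` on a boundary face (where the
sum over the other adjacent elements is empty). -/
def jump (w : T.BrokenField) (F : T.faces) (x : Pt d) (i : Fin d) : ℝ :=
  evalAt x (w (T.plus F) i) - ∑ K ∈ (T.adj F).erase (T.plus F), evalAt x (w K i)

/-- The average `{{∇_h w + ∇_h wᵀ - (2/3) (∇_h · w) 𝕀}}` on a face: the mean of the two one-sided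
values on an interior face, the one-sided value on a boundary face. -/
def avgStress (w : T.BrokenField) (F : T.faces) (x : Pt d) (i j : Fin d) : ℝ :=
  ((T.adj F).card : ℝ)⁻¹ * ∑ K ∈ T.adj F, evalAt x (stress (w K) i j)

/-- The diameter `h_F` of a face. -/
def faceDiam (F : T.faces) : ℝ := Metric.diam F.1

/-- The surface integral over a face (arc length for `d = 2`, area for `d = 3`). -/
def faceIntegral (F : T.faces) (f : Pt d → ℝ) : ℝ :=
  ∫ x in F.1, f x ∂(Measure.euclideanHausdorffMeasure (d - 1))

/-- `⟨[[v]], {{∇_h w + ∇_h wᵀ - (2/3) (∇_h · w) 𝕀}} n_F⟩` summed over all faces. -/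
def consistencyTerm (v w : T.BrokenField) : ℝ :=
  ∑ F : T.faces, T.faceIntegral F fun x =>
    ∑ i, T.jump v F x i * ∑ j, T.avgStress w F x i j * T.normal F j

/-- The viscous bilinear form `a_h(v, w)` with penalty parameter `η`. -/
def viscousForm (η : ℝ) (v w : T.BrokenField) : ℝ :=
  (∑ K : T.elements, ∫ x in K.1,
    ∑ i, ∑ j, evalAt x (stress (v K) i j) * evalAt x (grad (w K) i j))
  - T.consistencyTerm v w - T.consistencyTerm w v
  + ∑ F : T.faces, T.faceIntegral F fun x =>
      η / T.faceDiam F * ∑ i, T.jump v F x i * T.jump w F x i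

/-- `|||w|||_sym`. -/
def normSym (w : T.BrokenField) : ℝ :=
  Real.sqrt
    ((∑ K : T.elements, ∫ x in K.1, ∑ i, ∑ j, evalAt x (stress (w K) i j) ^ 2)
      + ∑ F : T.faces, T.faceIntegral F fun x =>
          1 / T.faceDiam F * ∑ i, T.jump w F x i ^ 2)

/-- `‖∇_h · w‖` in `L²(Ω)`. -/
def divNorm (w : T.BrokenField) : ℝ :=
  Real.sqrt (∑ K : T.elements, ∫ x in K.1, evalAt x (divergence (w K)) ^ 2)

/-- The stronger norm `(|||w|||_sym² + (4/9) (3 - d) ‖∇_h · w‖²)^{1/2}`. -/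
def normSymSup (w : T.BrokenField) : ℝ :=
  Real.sqrt (T.normSym w ^ 2 + 4 / 9 * (3 - (d : ℝ)) * T.divNorm w ^ 2)

/-- `f ∈ H₀(div; Ω)`: `f ∈ L²(Ω)` has a weak divergence `g ∈ L²(Ω)`, and its normal trace vanishes.
Testing with functions that need not vanish on `∂Ω` encodes both: by Green's formula the difference
of the two sides is the pairing of `f · n` with `φ` on `∂Ω`. -/
def MemH0div (f : Pt d → Pt d) : Prop :=
  MemLp f 2 (volume.restrict T.domain) ∧
  ∃ g : Pt d → ℝ, MemLp g 2 (volume.restrict T.domain) ∧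
    ∀ φ : Pt d → ℝ, ContDiff ℝ ∞ φ → HasCompactSupport φ →
      ∫ x in T.domain, ⟪f x, gradient φ x⟫ = - ∫ x in T.domain, g x * φ x

/-- `W` is a discrete velocity space `W_h ⊂ H₀(div; Ω)` whose members are polynomial fields of
degree at most `m` on every element. -/
def IsVelocitySpace (m : ℕ) (W : Submodule ℝ T.BrokenField) : Prop :=
  ∀ w ∈ W, (∀ K i, (w K i).totalDegree ≤ m) ∧ T.MemH0div (BrokenField.toFun w)

/-- `C_tr`: the best constant in the discrete trace inequality
`h_K^{1/2} ‖p‖_{L²(F)} ≤ C_tr ‖p‖_{L²(K)}`, over all elements `K`, all faces `F` of `K` and all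
polynomials `p` of degree at most `m`. -/
def traceConst (m : ℕ) : ℝ :=
  sInf {c : ℝ | 0 ≤ c ∧ ∀ (K : T.elements) (F : T.faces), IsFacet K.1 F.1 →
    ∀ p : MvPolynomial (Fin d) ℝ, p.totalDegree ≤ m →
      Metric.diam K.1 * T.faceIntegral F (fun x => evalAt x p ^ 2)
        ≤ c ^ 2 * ∫ x in K.1, evalAt x p ^ 2}

open Classical in
/-- `N_∂`: the largest number of faces of an element. -/
def maxFaces : ℕ :=
  T.elements.sup fun K => (T.faces.filter fun F => IsFacet K F).card

/-- Shape regularity with parameter `σ`: each element contains a ball of radius `r > 0` with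
`h_K ≤ σ r`. -/
def ShapeRegular (σ : ℝ) : Prop :=
  ∀ K ∈ T.elements, ∃ (x : Pt d) (r : ℝ), 0 < r ∧ Metric.closedBall x r ⊆ K ∧
    Metric.diam K ≤ σ * r

end Mesh

/-- `N` is a norm on the subspace `W`. -/
def IsNormOn {V : Type*} [AddCommGroup V] [Module ℝ V] (W : Submodule ℝ V) (N : V → ℝ) : Prop :=
  (∀ w ∈ W, 0 ≤ N w) ∧ (∀ w ∈ W, N w = 0 → w = 0) ∧
  (∀ (a : ℝ), ∀ w ∈ W, N (a • w) = |a| * N w) ∧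
  ∀ v ∈ W, ∀ w ∈ W, N (v + w) ≤ N v + N w

end ViscousDG

end

/-! Coercivity. The stress `τ` is symmetric with trace `2/3 (3 - d) ∇·w`, so `τ : ∇w = 1/2 |τ|² +
2/9 (3 - d) (∇·w)²` pointwise (`stress_inner_grad`). The volume and penalty terms thus already have
the shape of the squared norm, and only the consistency terms must be absorbed. Young's inequality
on each face bounds them by `θ` times the weighted jumps plus `h_F / θ` times the squared stress on
the face (`young_face`). The trace inequality and `h_F ≤ h_K` turn the latter into element
integrals, each element being counted at most `N` times, for a total of `c² N / θ ‖τ‖²`. Absorption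
works when `2 c² N < θ < η`.

Trace constant. Scaling the inscribed ball to the unit ball puts the element inside a ball of radius
`σ`. Polynomials of degree at most `m` form a finite-dimensional space, so their supremum there is
controlled by their L² norm on the unit ball. A face has measure at most a constant times `h_K ^ (d
- 1)`, and the powers of `h_K` and `r` cancel.

Definiteness. A polynomial field with zero stress that vanishes on a hyperplane is zero
(`eq_zero_of_stress_eq_zero`): its gradient there has rank one, the stress condition kills it, and
induction on the degree applies to the partial derivatives. If the norm of `w` is zero while `w` is
not, consider the elements on which `w` is nonzero. Some facet belongs to just one of them
(`exists_facet_of_single`). The vanishing jump makes that element's field vanish on the facet, hence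
on its hyperplane, hence identically. -/

namespace ViscousDG

/-! ### Polynomials as analytic functions: derivatives, degrees, affine substitution. -/

section Polynomials

variable {d : ℕ}

@[simp] lemma evalAt_zero (x : Pt d) : evalAt x 0 = 0 := by simp [evalAt]

@[simp] lemma evalAt_add (x : Pt d) (p q : MvPolynomial (Fin d) ℝ) :
    evalAt x (p + q) = evalAt x p + evalAt x q := by simp [evalAt]

@[simp] lemma evalAt_sub (x : Pt d) (p q : MvPolynomial (Fin d) ℝ) :
    evalAt x (p - q) = evalAt x p - evalAt x q := by simp [evalAt]

@[simp] lemma evalAt_smul (x : Pt d) (a : ℝ) (p : MvPolynomial (Fin d) ℝ) :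
    evalAt x (a • p) = a * evalAt x p := by simp [evalAt]

@[simp] lemma evalAt_C_mul (x : Pt d) (a : ℝ) (p : MvPolynomial (Fin d) ℝ) :
    evalAt x (MvPolynomial.C a * p) = a * evalAt x p := by simp [evalAt]

@[simp] lemma evalAt_sum {ι : Type*} (s : Finset ι) (x : Pt d) (p : ι → MvPolynomial (Fin d) ℝ) :
    evalAt x (∑ i ∈ s, p i) = ∑ i ∈ s, evalAt x (p i) := by simp [evalAt]

lemma analyticOnNhd_evalAt (p : MvPolynomial (Fin d) ℝ) (s : Set (Pt d)) :
    AnalyticOnNhd ℝ (fun x => evalAt x p) s := by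
  have h := AnalyticOnNhd.aeval_mvPolynomial (𝕜 := ℝ) (A := ℝ) (B := ℝ)
    (f := fun (x : Pt d) i => x i) (s := s)
    (fun i => (EuclideanSpace.proj i : Pt d →L[ℝ] ℝ).analyticOnNhd s) p
  exact h

@[fun_prop]
lemma continuous_evalAt (p : MvPolynomial (Fin d) ℝ) : Continuous fun x : Pt d => evalAt x p :=
  continuousOn_univ.1 (analyticOnNhd_evalAt p univ).continuousOn

lemma evalAt_eq_zero_of_isOpen {p : MvPolynomial (Fin d) ℝ} {U : Set (Pt d)} (hU : IsOpen U)
    (hne : U.Nonempty) (h : ∀ x ∈ U, evalAt x p = 0) : p = 0 := by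
  obtain ⟨x₀, hx₀⟩ := hne
  have := (analyticOnNhd_evalAt p univ).eq_of_eventuallyEq (g := fun _ => 0)
    (analyticOnNhd_const) (z₀ := x₀)
    (Filter.eventuallyEq_of_mem (hU.mem_nhds hx₀) h)
  refine MvPolynomial.funext fun y => ?_
  simpa [evalAt] using congrFun this (WithLp.toLp 2 y)

lemma hasFDerivAt_evalAt (p : MvPolynomial (Fin d) ℝ) (x : Pt d) :
    HasFDerivAt (fun y => evalAt y p)
      (∑ j, evalAt x (MvPolynomial.pderiv j p) •
        (EuclideanSpace.proj j : Pt d →L[ℝ] ℝ)) x := by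
  induction p using MvPolynomial.induction_on with
  | C a => simpa [evalAt] using hasFDerivAt_const a x
  | add p q hp hq =>
    refine ((hp.add hq).congr_fderiv ?_).congr_of_eventuallyEq
      (Filter.Eventually.of_forall fun y => by simp)
    simp [add_smul, Finset.sum_add_distrib]
  | mul_X p i hp =>
    have h := hp.mul ((EuclideanSpace.proj i : Pt d →L[ℝ] ℝ).hasFDerivAt (x := x))
    refine (h.congr_fderiv ?_).congr_of_eventuallyEq (Filter.Eventually.of_forall fun y => ?_)
    · ext v
      simp only [evalAt, Derivation.leibniz, MvPolynomial.pderiv_X, smul_eq_mul, map_add, map_mul,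
        MvPolynomial.eval_X, PiLp.proj_apply, add_apply, smul_apply, sum_apply, add_mul,
        Finset.sum_add_distrib, Finset.mul_sum]
      congr 1
      · rw [Finset.sum_eq_single i] <;> simp +contextual [eq_comm]
      · exact Finset.sum_congr rfl fun j _ => by ring
    · simp [evalAt]

lemma hasDerivAt_evalAt_line (p : MvPolynomial (Fin d) ℝ) (x v : Pt d) :
    HasDerivAt (fun t : ℝ => evalAt (x + t • v) p)
      (∑ j, evalAt x (MvPolynomial.pderiv j p) * v j) 0 := by
  have h1 : HasDerivAt (fun t : ℝ => x + t • v) v 0 := by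
    simpa using ((hasDerivAt_id (0 : ℝ)).smul_const v).const_add x
  have h2 := hasFDerivAt_evalAt p (x + (0 : ℝ) • v)
  have := h2.comp_hasDerivAt (0 : ℝ) h1
  refine (this.congr_deriv ?_).congr_of_eventuallyEq (Filter.Eventually.of_forall fun y => rfl)
  simp

lemma totalDegree_pderiv_le (j : Fin d) (p : MvPolynomial (Fin d) ℝ) :
    (MvPolynomial.pderiv j p).totalDegree ≤ p.totalDegree - 1 := by
  conv_lhs => rw [p.as_sum, map_sum]
  refine MvPolynomial.totalDegree_finsetSum_le fun s hs => ?_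
  rw [MvPolynomial.pderiv_monomial]
  by_cases hj : s j = 0
  · simp [hj]
  refine (MvPolynomial.totalDegree_monomial_le _ _).trans ?_
  have h1 := MvPolynomial.le_totalDegree hs
  have h2 : (s - Finsupp.single j 1).degree + 1 = s.degree := by
    have h3 : s - Finsupp.single j 1 + Finsupp.single j 1 = s :=
      tsub_add_cancel_of_le (by simpa using Nat.one_le_iff_ne_zero.2 hj)
    conv_rhs => rw [← h3]
    simp
  change s.degree ≤ _ at h1
  change (s - Finsupp.single j 1).degree ≤ _
  omega

lemma totalDegree_bind₁_le {f : Fin d → MvPolynomial (Fin d) ℝ} (hf : ∀ i, (f i).totalDegree ≤ 1)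
    (p : MvPolynomial (Fin d) ℝ) : (MvPolynomial.bind₁ f p).totalDegree ≤ p.totalDegree := by
  conv_lhs => rw [p.as_sum, map_sum]
  refine MvPolynomial.totalDegree_finsetSum_le fun s hs => ?_
  rw [MvPolynomial.bind₁_monomial]
  refine (MvPolynomial.totalDegree_mul _ _).trans ?_
  rw [MvPolynomial.totalDegree_C, zero_add]
  refine (MvPolynomial.totalDegree_finsetProd _ _).trans ?_
  refine le_trans (Finset.sum_le_sum fun i _ => ?_) (MvPolynomial.le_totalDegree hs)
  exact (MvPolynomial.totalDegree_pow _ _).trans ((Nat.mul_le_mul_left _ (hf i)).trans (by simp))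

/-- Affine substitution does not raise the degree, so an estimate on the unit ball transfers to
every ball with the same constant. -/
lemma exists_evalAt_rescale (p : MvPolynomial (Fin d) ℝ) (x : Pt d) (r : ℝ) :
    ∃ q : MvPolynomial (Fin d) ℝ, q.totalDegree ≤ p.totalDegree ∧
      ∀ y, evalAt y q = evalAt (x + r • y) p := by
  refine ⟨MvPolynomial.bind₁ (fun i => MvPolynomial.C (x i) + MvPolynomial.C r * MvPolynomial.X i) p,
    totalDegree_bind₁_le (fun i => ?_) p, fun y => ?_⟩
  · refine (MvPolynomial.totalDegree_add _ _).trans (max_le (by simp) ?_)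
    refine (MvPolynomial.totalDegree_mul _ _).trans (by simp)
  · simp only [evalAt, MvPolynomial.eval, MvPolynomial.eval₂Hom_bind₁]
    congr 2
    ext i
    simp

end Polynomials

/-! ### Surface measure of faces through isometric charts. -/

section FaceMeasure

variable {d : ℕ}

lemma exists_isometric_chart {F : Set (Pt d)} (hF : Module.finrank ℝ (vectorSpan ℝ F) + 1 = d) :
    ∃ L : Pt (d - 1) →ₗᵢ[ℝ] Pt d, LinearMap.range L.toLinearMap = vectorSpan ℝ F := by
  have h : Module.finrank ℝ (vectorSpan ℝ F) = d - 1 := by omega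
  let b := (stdOrthonormalBasis ℝ (vectorSpan ℝ F)).reindex (finCongr h)
  refine ⟨(vectorSpan ℝ F).subtypeₗᵢ.comp b.repr.symm.toLinearIsometry, ?_⟩
  ext x
  constructor
  · rintro ⟨v, rfl⟩
    exact (b.repr.symm v).2
  · intro hx
    exact ⟨b.repr ⟨x, hx⟩, by simp⟩

lemma image_preimage_chart {F : Set (Pt d)} {L : Pt (d - 1) →ₗᵢ[ℝ] Pt d}
    (hL : LinearMap.range L.toLinearMap = vectorSpan ℝ F) {x₀ : Pt d} (hx₀ : x₀ ∈ F) :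
    (fun v => x₀ + L v) '' ((fun v => x₀ + L v) ⁻¹' F) = F := by
  refine image_preimage_eq_of_subset fun x hx => ?_
  have : x - x₀ ∈ LinearMap.range L.toLinearMap := by
    rw [hL]; exact vsub_mem_vectorSpan ℝ hx hx₀
  obtain ⟨v, hv⟩ := this
  refine ⟨v, ?_⟩
  have hv' : L v = x - x₀ := hv
  simp [hv']

lemma isometry_chart (L : Pt (d - 1) →ₗᵢ[ℝ] Pt d) (x₀ : Pt d) :
    Isometry fun v => x₀ + L v :=
  (IsometryEquiv.addLeft x₀).isometry.comp L.isometry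

/-- Hausdorff measure is invariant under isometries and agrees with Lebesgue measure on `ℝ^(d-1)`;
questions about a face become questions about Lebesgue measure. -/
lemma faceMeasure_eq_volume {F : Set (Pt d)} {L : Pt (d - 1) →ₗᵢ[ℝ] Pt d}
    (hL : LinearMap.range L.toLinearMap = vectorSpan ℝ F) {x₀ : Pt d} (hx₀ : x₀ ∈ F)
    {A : Set (Pt d)} (hA : A ⊆ F) :
    Measure.euclideanHausdorffMeasure (d - 1) A = volume ((fun v => x₀ + L v) ⁻¹' A) := by
  have h : (fun v => x₀ + L v) '' ((fun v => x₀ + L v) ⁻¹' A) = A := by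
    refine image_preimage_eq_of_subset (hA.trans ?_)
    rw [← image_preimage_chart hL hx₀]
    exact image_subset_range _ _
  rw [← EuclideanSpace.euclideanHausdorffMeasure_eq_volume,
    ← (isometry_chart L x₀).euclideanHausdorffMeasure_image, h]

/-- In a chart centred at a point of `F`, the face lies in the ball about `0` whose radius is its
diameter. -/
lemma faceMeasure_le {F : Set (Pt d)} (hF : Module.finrank ℝ (vectorSpan ℝ F) + 1 = d)
    (hb : Bornology.IsBounded F) :
    Measure.euclideanHausdorffMeasure (d - 1) F ≤
      ENNReal.ofReal (Metric.diam F ^ (d - 1)) * volume (Metric.ball (0 : Pt (d - 1)) 1) := by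
  rcases F.eq_empty_or_nonempty with rfl | ⟨x₀, hx₀⟩
  · simp
  obtain ⟨L, hL⟩ := exists_isometric_chart hF
  rw [faceMeasure_eq_volume hL hx₀ subset_rfl]
  have := Measure.addHaar_closedBall (volume : Measure (Pt (d - 1))) 0 (Metric.diam_nonneg (s := F))
  rw [finrank_euclideanSpace_fin] at this
  rw [← this]
  refine measure_mono fun v hv => ?_
  have h := Metric.dist_le_diam_of_mem hb hv hx₀
  simpa [dist_eq_norm] using h

lemma faceMeasure_lt_top {F : Set (Pt d)} (hF : Module.finrank ℝ (vectorSpan ℝ F) + 1 = d)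
    (hb : Bornology.IsBounded F) : Measure.euclideanHausdorffMeasure (d - 1) F < ⊤ :=
  (faceMeasure_le hF hb).trans_lt
    (ENNReal.mul_lt_top ENNReal.ofReal_lt_top Metric.isBounded_ball.measure_lt_top)

lemma vectorSpan_eq_orthogonal {F : Set (Pt d)}
    (hF : Module.finrank ℝ (vectorSpan ℝ F) + 1 = d) {n : Pt d} (hn : n ≠ 0)
    (h : ∀ x ∈ F, ∀ y ∈ F, ⟪n, x⟫ = ⟪n, y⟫) : vectorSpan ℝ F = (ℝ ∙ n)ᗮ := by
  refine Submodule.eq_of_le_of_finrank_eq ?_ ?_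
  · rw [vectorSpan_def, Submodule.span_le]
    rintro _ ⟨x, hx, y, hy, rfl⟩
    rw [SetLike.mem_coe, Submodule.mem_orthogonal_singleton_iff_inner_right]
    change ⟪n, x - y⟫ = 0
    rw [inner_sub_right, h x hx y hy, sub_self]
  · have := Submodule.finrank_add_finrank_orthogonal (ℝ ∙ n)
    rw [finrank_span_singleton hn, finrank_euclideanSpace_fin] at this
    omega

/-- An analytic function that vanishes almost everywhere on a convex set of dimension `d - 1`
vanishes on the hyperplane containing it. -/
lemma eq_zero_on_hyperplane {F : Set (Pt d)}
    (hF : Module.finrank ℝ (vectorSpan ℝ F) + 1 = d) (hconv : Convex ℝ F) {n : Pt d} (hn : n ≠ 0)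
    (h : ∀ x ∈ F, ∀ y ∈ F, ⟪n, x⟫ = ⟪n, y⟫) {g : Pt d → ℝ} (hg : AnalyticOnNhd ℝ g univ)
    (h0 : Measure.euclideanHausdorffMeasure (d - 1) {x ∈ F | g x ≠ 0} = 0)
    {x₀ : Pt d} (hx₀ : x₀ ∈ F) {v : Pt d} (hv : ⟪n, v⟫ = 0) : g (x₀ + v) = 0 := by
  obtain ⟨L, hL⟩ := exists_isometric_chart hF
  set φ : Pt (d - 1) → Pt d := fun v => x₀ + L v with hφ
  have hgφ : AnalyticOnNhd ℝ (g ∘ φ) univ :=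
    hg.comp (analyticOnNhd_const.add (L.toContinuousLinearMap.analyticOnNhd univ))
      (mapsTo_univ _ _)
  let Φ : Pt (d - 1) →ᵃ[ℝ] Pt d := AffineMap.const ℝ _ x₀ + L.toLinearMap.toAffineMap
  have hΦ : ⇑Φ = φ := rfl
  set A := φ ⁻¹' F with hA
  have hAF : φ '' A = F := image_preimage_chart hL hx₀
  have hAc : Convex ℝ A := by rw [hA, ← hΦ]; exact hconv.affine_preimage Φ
  -- The pulled-back face has full dimension `d - 1`; being convex, it then has nonempty interior,
  -- where the identity theorem can start.
  have hspan : affineSpan ℝ A = ⊤ := by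
    have hmap : (vectorSpan ℝ A).map L.toLinearMap = vectorSpan ℝ F := by
      rw [← hAF, ← hΦ, ← AffineMap.map_vectorSpan]
      congr 1
      ext v
      simp [Φ]
    have hfin : Module.finrank ℝ (vectorSpan ℝ A) = Module.finrank ℝ (Pt (d - 1)) := by
      have := (Submodule.equivMapOfInjective L.toLinearMap L.injective (vectorSpan ℝ A)).finrank_eq
      rw [hmap] at this
      rw [this, finrank_euclideanSpace_fin]
      omega
    have hA0 : A.Nonempty := ⟨0, by simp [hA, hφ, hx₀]⟩
    rw [AffineSubspace.affineSpan_eq_top_iff_vectorSpan_eq_top_of_nonempty ℝ _ _ hA0]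
    exact Submodule.eq_top_of_finrank_eq hfin
  have hint : (interior A).Nonempty := hAc.interior_nonempty_iff_affineSpan_eq_top.2 hspan
  have hae : volume {x ∈ A | g (φ x) ≠ 0} = 0 := by
    rw [← h0, faceMeasure_eq_volume hL hx₀ (sep_subset _ _)]
    rfl
  have hzero : EqOn (g ∘ φ) (fun _ => 0) (interior A) := by
    refine Measure.eqOn_open_of_ae_eq (μ := volume) ?_ isOpen_interior
      (hgφ.continuousOn.mono (subset_univ _)) continuousOn_const
    rw [Filter.EventuallyEq, ae_restrict_iff' isOpen_interior.measurableSet, ae_iff]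
    refine measure_mono_null (fun x hx => ?_) hae
    simp only [Classical.not_imp, mem_ofPred_eq] at hx
    exact ⟨interior_subset hx.1, hx.2⟩
  obtain ⟨y, hy⟩ := hint
  have hall := hgφ.eq_of_eventuallyEq (g := fun _ => 0) analyticOnNhd_const (z₀ := y)
    (Filter.eventuallyEq_of_mem (isOpen_interior.mem_nhds hy) hzero)
  have hvm : v ∈ LinearMap.range L.toLinearMap := by
    rw [hL, vectorSpan_eq_orthogonal hF hn h,
      Submodule.mem_orthogonal_singleton_iff_inner_right]
    exact hv
  obtain ⟨u, rfl⟩ := hvm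
  exact congrFun hall u

end FaceMeasure

/-! ### Compactness, convexity and integrability on polytopes and facets. -/

section Polytopes

variable {d : ℕ} {K F : Set (Pt d)}

lemma IsPolytope.isCompact (hK : IsPolytope K) : IsCompact K := by
  obtain ⟨⟨s, rfl⟩, -⟩ := hK
  exact s.finite_toSet.isCompact_convexHull ℝ

lemma IsPolytope.convex (hK : IsPolytope K) : Convex ℝ K := by
  obtain ⟨⟨s, rfl⟩, -⟩ := hK
  exact convex_convexHull ℝ _

lemma IsFacet.subset (hF : IsFacet K F) : F ⊆ K := hF.1.subset

lemma IsFacet.isCompact (hF : IsFacet K F) (hK : IsPolytope K) : IsCompact F :=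
  hF.1.isCompact hK.isCompact

lemma IsFacet.convex (hF : IsFacet K F) (hK : IsPolytope K) : Convex ℝ F :=
  hF.1.convex hK.convex

lemma IsFacet.measure_lt_top (hF : IsFacet K F) (hK : IsPolytope K) :
    Measure.euclideanHausdorffMeasure (d - 1) F < ⊤ :=
  faceMeasure_lt_top hF.2 (hF.isCompact hK).isBounded

lemma IsFacet.nontrivial (hF : IsFacet K F) (hd : 2 ≤ d) : F.Nontrivial := by
  by_contra h
  have := hF.2
  rw [vectorSpan_of_subsingleton ℝ (not_nontrivial_iff.1 h)] at this
  simp at this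
  omega

lemma IsFacet.integrableOn (hF : IsFacet K F) (hK : IsPolytope K) {f : Pt d → ℝ}
    (hf : Continuous f) : IntegrableOn f F (Measure.euclideanHausdorffMeasure (d - 1)) := by
  obtain ⟨C, hC⟩ := (hF.isCompact hK).exists_bound_of_continuousOn hf.continuousOn
  have : IsFiniteMeasure ((Measure.euclideanHausdorffMeasure (d - 1)).restrict F) :=
    ⟨by simpa using hF.measure_lt_top hK⟩
  refine Integrable.of_bound hf.aestronglyMeasurable C ?_
  exact (ae_restrict_mem (hF.isCompact hK).measurableSet).mono hC

lemma IsPolytope.integrableOn (hK : IsPolytope K) {f : Pt d → ℝ}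
    (hf : Continuous f) : IntegrableOn f K :=
  hf.continuousOn.integrableOn_compact hK.isCompact

end Polytopes

/-! ### The discrete trace inequality on one element. -/

section Trace

variable {d : ℕ}

lemma evalAt_eq_zero_of_integral_sq {A : Set (Pt d)} (hA : IsCompact A)
    (hne : (interior A).Nonempty) {p : MvPolynomial (Fin d) ℝ}
    (h : ∫ x in A, evalAt x p ^ 2 = 0) : p = 0 := by
  refine evalAt_eq_zero_of_isOpen isOpen_interior hne ?_
  have hc : Continuous fun x => evalAt x p ^ 2 := by fun_prop
  have h1 := (setIntegral_eq_zero_iff_of_nonneg_ae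
    (Filter.Eventually.of_forall fun x => sq_nonneg (evalAt x p))
    (hc.continuousOn.integrableOn_compact hA)).1 h
  have h2 := Measure.eqOn_open_of_ae_eq (ae_restrict_of_ae_restrict_of_subset interior_subset h1)
    isOpen_interior hc.continuousOn continuousOn_const
  exact fun x hx => by simpa using h2 hx

lemma exists_sq_apply_le {V : Type*} [NormedAddCommGroup V] [InnerProductSpace ℝ V]
    [FiniteDimensional ℝ V] {X : Type*} [TopologicalSpace X] [CompactSpace X]
    (E : V →ₗ[ℝ] C(X, ℝ)) :
    ∃ C : ℝ, 0 ≤ C ∧ ∀ p y, E p y ^ 2 ≤ C * inner ℝ p p := by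
  let E' := E.toContinuousLinearMap
  refine ⟨‖E'‖ ^ 2, by positivity, fun p y => ?_⟩
  have h1 : ‖E p y‖ ≤ ‖E'‖ * ‖p‖ :=
    ((E' p).norm_coe_le_norm y).trans (E'.le_opNorm p)
  rw [real_inner_self_eq_norm_sq, ← mul_pow, ← sq_abs]
  exact pow_le_pow_left₀ (abs_nonneg _) h1 2

/-- On a finite-dimensional space of continuous functions on a compact space, any inner product
controls the supremum norm. -/
lemma exists_sq_apply_le_core {V : Type*} [AddCommGroup V] [Module ℝ V] [FiniteDimensional ℝ V]
    (core : InnerProductSpace.Core ℝ V) {X : Type*} [TopologicalSpace X] [CompactSpace X]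
    (E : V →ₗ[ℝ] C(X, ℝ)) :
    ∃ C : ℝ, 0 ≤ C ∧ ∀ p y, E p y ^ 2 ≤ C * core.inner p p :=
  @exists_sq_apply_le V core.toNormedAddCommGroup (InnerProductSpace.ofCore core.toCore) ‹_› X _ _ E

/-- The L² product on the unit ball is definite on polynomials, and restriction to the ball of
radius `σ` is a linear map from a finite-dimensional space, hence bounded. -/
lemma exists_sq_evalAt_le (d m : ℕ) (σ : ℝ) : ∃ c : ℝ, 0 ≤ c ∧
    ∀ p : MvPolynomial (Fin d) ℝ, p.totalDegree ≤ m → ∀ y ∈ Metric.closedBall (0 : Pt d) σ,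
      evalAt y p ^ 2 ≤ c * ∫ x in Metric.closedBall (0 : Pt d) 1, evalAt x p ^ 2 := by
  let V := MvPolynomial.restrictTotalDegree (Fin d) ℝ m
  set B := Metric.closedBall (0 : Pt d) 1 with hB
  have hBc : IsCompact B := isCompact_closedBall _ _
  have hint (p q : MvPolynomial (Fin d) ℝ) : IntegrableOn (fun x => evalAt x p * evalAt x q) B :=
    Continuous.continuousOn (by fun_prop) |>.integrableOn_compact hBc
  let core : InnerProductSpace.Core ℝ V :=
    { inner := fun p q => ∫ x in B, evalAt x p.1 * evalAt x q.1
      conj_inner_symm := fun p q => by simp [mul_comm]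
      re_inner_nonneg := fun p => integral_nonneg fun x => mul_self_nonneg _
      add_left := fun p q s => by
        simp only [Submodule.coe_add, evalAt_add, add_mul]
        exact integral_add (hint _ _) (hint _ _)
      smul_left := fun p q a => by
        simp only [Submodule.coe_smul, evalAt_smul, mul_assoc]
        exact integral_const_mul _ _
      definite := fun p hp => by
        refine Subtype.ext (evalAt_eq_zero_of_integral_sq hBc ?_ (A := B) ?_)
        · rw [hB, interior_closedBall _ one_ne_zero]
          exact ⟨0, by simp⟩
        · simpa [pow_two] using hp }
  have : CompactSpace (Metric.closedBall (0 : Pt d) σ) :=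
    isCompact_iff_compactSpace.1 (isCompact_closedBall _ _)
  let E : V →ₗ[ℝ] C(Metric.closedBall (0 : Pt d) σ, ℝ) :=
    { toFun := fun p => ⟨fun y => evalAt y.1 p.1, by fun_prop⟩
      map_add' := fun p q => by ext; simp
      map_smul' := fun a p => by ext; simp }
  obtain ⟨c, hc, H⟩ := exists_sq_apply_le_core core E
  refine ⟨c, hc, fun p hp y hy => ?_⟩
  simp only [pow_two]
  have := H ⟨p, (MvPolynomial.mem_restrictTotalDegree _ _ _).2 hp⟩ ⟨y, hy⟩
  rw [pow_two] at this
  exact this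

lemma setIntegral_closedBall_rescale (f : Pt d → ℝ) (x : Pt d) {r : ℝ} (hr : 0 < r) :
    ∫ y in Metric.closedBall (0 : Pt d) 1, f (x + r • y) =
      (r ^ d)⁻¹ * ∫ y in Metric.closedBall x r, f y := by
  have h1 := Measure.setIntegral_comp_smul_of_pos (volume : Measure (Pt d)) (fun z => f (x + z))
    (Metric.closedBall 0 1) hr
  rw [finrank_euclideanSpace_fin, smul_eq_mul, _root_.smul_closedBall _ _ zero_le_one] at h1
  rw [h1]
  congr 1
  have h2 := (measurePreserving_add_left (volume : Measure (Pt d)) x).setIntegral_preimage_emb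
    (measurableEmbedding_addLeft x) f (Metric.closedBall x r)
  rw [← h2]
  simp [abs_of_pos hr]

/-- The discrete trace inequality on a convex polytope, with a constant depending only on the
degree, the dimension and the ratio of the diameter to the radius of an inscribed ball. -/
lemma exists_trace_inequality (d m : ℕ) (hd : 2 ≤ d) (σ : ℝ) : ∃ c : ℝ, 0 ≤ c ∧
    ∀ K F : Set (Pt d), IsPolytope K → IsFacet K F →
      (∃ (x : Pt d) (r : ℝ), 0 < r ∧ Metric.closedBall x r ⊆ K ∧ Metric.diam K ≤ σ * r) →
      ∀ p : MvPolynomial (Fin d) ℝ, p.totalDegree ≤ m →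
        Metric.diam K * ∫ x in F, evalAt x p ^ 2 ∂(Measure.euclideanHausdorffMeasure (d - 1)) ≤
          c ^ 2 * ∫ x in K, evalAt x p ^ 2 := by
  obtain ⟨c₁, hc₁, H⟩ := exists_sq_evalAt_le d m σ
  set β := (volume (Metric.ball (0 : Pt (d - 1)) 1)).toReal with hβ
  have hβ0 : 0 ≤ β := ENNReal.toReal_nonneg
  -- The reference estimate contributes `c₁ r^(-d)` and the face measure `β h_K^(d-1)`. With the
  -- extra factor `h_K`, the bound `h_K ^ d ≤ (|σ| r) ^ d` cancels `r`.
  refine ⟨√(|σ| ^ d * β * c₁), Real.sqrt_nonneg _, fun K F hK hF ⟨x, r, hr, hball, hσ⟩ p hp => ?_⟩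
  rw [Real.sq_sqrt (by positivity)]
  have hbd := hK.isCompact.isBounded
  set I := ∫ y in K, evalAt y p ^ 2 with hI
  have hI0 : 0 ≤ I := integral_nonneg fun y => sq_nonneg _
  have hpt : ∀ y ∈ K, evalAt y p ^ 2 ≤ c₁ * ((r ^ d)⁻¹ * I) := by
    intro y hy
    obtain ⟨q, hq, hqe⟩ := exists_evalAt_rescale p x r
    -- The centre of the ball lies in `K`, so `y` is within `diam K ≤ σ r` of it.
    have hmem : r⁻¹ • (y - x) ∈ Metric.closedBall (0 : Pt d) σ := by
      have := Metric.dist_le_diam_of_mem hbd hy (hball (Metric.mem_closedBall_self hr.le))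
      rw [dist_eq_norm] at this
      rw [mem_closedBall_zero_iff, norm_smul, norm_inv, Real.norm_of_nonneg hr.le,
        inv_mul_le_iff₀ hr, mul_comm]
      exact this.trans hσ
    have h1 := H q (hq.trans hp) _ hmem
    simp only [hqe] at h1
    rw [smul_inv_smul₀ hr.ne', add_sub_cancel,
      setIntegral_closedBall_rescale (fun y => evalAt y p ^ 2) x hr] at h1
    refine h1.trans ?_
    gcongr
    exact setIntegral_mono_set (hK.integrableOn (by fun_prop))
      (Filter.Eventually.of_forall fun y => sq_nonneg _) hball.eventuallyLE
  set M := c₁ * ((r ^ d)⁻¹ * I) with hM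
  have hM0 : 0 ≤ M := by positivity
  have hdiam : 0 ≤ Metric.diam K := Metric.diam_nonneg
  have hFm : (Measure.euclideanHausdorffMeasure (d - 1) F).toReal ≤ Metric.diam K ^ (d - 1) * β := by
    have h1 := faceMeasure_le hF.2 (hF.isCompact hK).isBounded
    have h2 := ENNReal.toReal_mono
      (ENNReal.mul_ne_top ENNReal.ofReal_ne_top Metric.isBounded_ball.measure_lt_top.ne) h1
    rw [ENNReal.toReal_mul, ENNReal.toReal_ofReal (by positivity)] at h2
    refine h2.trans ?_
    gcongr
    exact Metric.diam_mono hF.subset hbd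
  have hFI : ∫ y in F, evalAt y p ^ 2 ∂(Measure.euclideanHausdorffMeasure (d - 1)) ≤
      M * (Metric.diam K ^ (d - 1) * β) := by
    have h1 := norm_setIntegral_le_of_norm_le_const (hF.measure_lt_top hK)
      (f := fun y => evalAt y p ^ 2) (C := M) fun y hy => by
        rw [Real.norm_of_nonneg (sq_nonneg _)]; exact hpt y (hF.subset hy)
    refine (Real.le_norm_self _).trans (h1.trans ?_)
    exact mul_le_mul_of_nonneg_left hFm hM0
  calc _ ≤ Metric.diam K * (M * (Metric.diam K ^ (d - 1) * β)) := by gcongr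
    _ = (Metric.diam K ^ (d - 1) * Metric.diam K) * (M * β) := by ring
    _ = Metric.diam K ^ d * (M * β) := by rw [← pow_succ, Nat.sub_add_cancel (by omega)]
    _ ≤ (|σ| * r) ^ d * (M * β) := by
        gcongr
        exact hσ.trans (by gcongr; exact le_abs_self σ)
    _ = |σ| ^ d * β * c₁ * I * (r ^ d * (r ^ d)⁻¹) := by rw [hM, mul_pow]; ring
    _ = _ := by rw [mul_inv_cancel₀ (by positivity), mul_one]

end Trace

/-! ### The trace constant of a mesh. -/

namespace Mesh

variable {d : ℕ} (T : Mesh d)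

/-- With finitely many elements, the largest of the individual ratios works. This makes the set of
trace constants nonempty, so that `traceConst` is not the default value of `sInf` on the empty set.
-/
lemma exists_shapeRegular : ∃ σ, T.ShapeRegular σ := by
  have h : ∀ K ∈ T.elements, ∃ σ : ℝ, ∃ (x : Pt d) (r : ℝ), 0 < r ∧ Metric.closedBall x r ⊆ K ∧
      Metric.diam K ≤ σ * r := by
    intro K hK
    obtain ⟨x, hx⟩ := (T.isPolytope K hK).2
    obtain ⟨r, hr, hb⟩ := Metric.nhds_basis_closedBall.mem_iff.1 (mem_interior_iff_mem_nhds.1 hx)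
    exact ⟨Metric.diam K / r, x, r, hr, hb, by field_simp; rfl⟩
  choose! σ hσ using h
  obtain ⟨M, hM⟩ := (T.elements.image σ).bddAbove
  refine ⟨M, fun K hK => ?_⟩
  obtain ⟨x, r, hr, hb, hdiam⟩ := hσ K hK
  exact ⟨x, r, hr, hb, hdiam.trans (mul_le_mul_of_nonneg_right
    (hM (by simpa using ⟨K, hK, rfl⟩)) hr.le)⟩

/-- The set of admissible constants in the discrete trace inequality. -/
def traceConstants (m : ℕ) : Set ℝ :=
  {c : ℝ | 0 ≤ c ∧ ∀ (K : T.elements) (F : T.faces), IsFacet K.1 F.1 →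
    ∀ p : MvPolynomial (Fin d) ℝ, p.totalDegree ≤ m →
      Metric.diam K.1 * T.faceIntegral F (fun x => evalAt x p ^ 2)
        ≤ c ^ 2 * ∫ x in K.1, evalAt x p ^ 2}

lemma exists_mem_traceConstants (hd : 2 ≤ d) (m : ℕ) (σ : ℝ) :
    ∃ c : ℝ, ∀ T : Mesh d, T.ShapeRegular σ → c ∈ T.traceConstants m := by
  obtain ⟨c, hc, H⟩ := exists_trace_inequality d m hd σ
  exact ⟨c, fun T hT => ⟨hc, fun K F hF p hp =>
    H K.1 F.1 (T.isPolytope _ K.2) hF (hT K.1 K.2) p hp⟩⟩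

lemma bddBelow_traceConstants (m : ℕ) : BddBelow (T.traceConstants m) := ⟨0, fun _ h => h.1⟩

/-- The admissible constants form a closed nonempty set bounded below, so the infimum is attained.
-/
lemma traceConst_mem (hd : 2 ≤ d) (m : ℕ) : T.traceConst m ∈ T.traceConstants m := by
  have hclosed : IsClosed (T.traceConstants m) := by
    have : T.traceConstants m = Ici 0 ∩ ⋂ (K : T.elements) (F : T.faces) (_ : IsFacet K.1 F.1)
        (p : MvPolynomial (Fin d) ℝ) (_ : p.totalDegree ≤ m),
        {c : ℝ | Metric.diam K.1 * T.faceIntegral F (fun x => evalAt x p ^ 2)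
          ≤ c ^ 2 * ∫ x in K.1, evalAt x p ^ 2} := by
      ext c
      simp [traceConstants]
    rw [this]
    refine isClosed_Ici.inter ?_
    refine isClosed_iInter fun K => isClosed_iInter fun F => isClosed_iInter fun _ =>
      isClosed_iInter fun p => isClosed_iInter fun _ => isClosed_le continuous_const (by fun_prop)
  obtain ⟨σ, hσ⟩ := T.exists_shapeRegular
  obtain ⟨c, hc⟩ := exists_mem_traceConstants hd m σ
  exact hclosed.csInf_mem ⟨c, hc T hσ⟩ (T.bddBelow_traceConstants m)

lemma trace_inequality (hd : 2 ≤ d) {m : ℕ} {c : ℝ} (hc : T.traceConst m ≤ c) (K : T.elements)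
    (F : T.faces) (hF : IsFacet K.1 F.1) {p : MvPolynomial (Fin d) ℝ} (hp : p.totalDegree ≤ m) :
    Metric.diam K.1 * T.faceIntegral F (fun x => evalAt x p ^ 2)
      ≤ c ^ 2 * ∫ x in K.1, evalAt x p ^ 2 := by
  obtain ⟨h0, h⟩ := T.traceConst_mem hd m
  refine (h K F hF p hp).trans ?_
  gcongr

lemma exists_traceConst_le (hd : 2 ≤ d) (m : ℕ) (σ : ℝ) :
    ∃ c : ℝ, ∀ T : Mesh d, T.ShapeRegular σ → T.traceConst m ≤ c := by
  obtain ⟨c, hc⟩ := exists_mem_traceConstants hd m σ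
  exact ⟨c, fun T hT => csInf_le (T.bddBelow_traceConstants m) (hc T hT)⟩

end Mesh

/-! ### Energy identity, consistency estimate and coercivity. -/

variable {d : ℕ}

@[fun_prop]
lemma Mesh.continuous_jump (T : Mesh d) (w : T.BrokenField) (F : T.faces) (i : Fin d) :
    Continuous fun x => T.jump w F x i := by
  unfold Mesh.jump; fun_prop

@[fun_prop]
lemma Mesh.continuous_avgStress (T : Mesh d) (w : T.BrokenField) (F : T.faces) (i j : Fin d) :
    Continuous fun x => T.avgStress w F x i j := by
  unfold Mesh.avgStress; fun_prop

lemma totalDegree_grad_le {m : ℕ} {w : PolyField d} (hw : ∀ i, (w i).totalDegree ≤ m)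
    (i j : Fin d) : (grad w i j).totalDegree ≤ m :=
  (totalDegree_pderiv_le j (w i)).trans ((Nat.sub_le _ _).trans (hw i))

lemma totalDegree_stress_le {m : ℕ} {w : PolyField d} (hw : ∀ i, (w i).totalDegree ≤ m)
    (i j : Fin d) : (stress w i j).totalDegree ≤ m := by
  refine (MvPolynomial.totalDegree_sub _ _).trans (max_le ?_ ?_)
  · exact (MvPolynomial.totalDegree_add _ _).trans
      (max_le (totalDegree_grad_le hw i j) (totalDegree_grad_le hw j i))
  · split_ifs
    · refine (MvPolynomial.totalDegree_mul _ _).trans ?_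
      rw [MvPolynomial.totalDegree_C, zero_add]
      exact MvPolynomial.totalDegree_finsetSum_le fun k _ => totalDegree_grad_le hw k k
    · simp

lemma evalAt_stress (x : Pt d) (w : PolyField d) (i j : Fin d) :
    evalAt x (stress w i j) = evalAt x (grad w i j) + evalAt x (grad w j i) -
      if i = j then 2 / 3 * ∑ k, evalAt x (grad w k k) else 0 := by
  simp only [stress, divergence, grad]
  split_ifs <;> simp

/-- The stress paired with the gradient splits into the squares of the stress and the
divergence. -/
lemma stress_inner_grad (hd : d = 2 ∨ d = 3) (x : Pt d) (w : PolyField d) :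
    ∑ i, ∑ j, evalAt x (stress w i j) * evalAt x (grad w i j) =
      1 / 2 * ∑ i, ∑ j, evalAt x (stress w i j) ^ 2 +
        2 / 9 * (3 - (d : ℝ)) * evalAt x (divergence w) ^ 2 := by
  have h : evalAt x (divergence w) = ∑ k, evalAt x (grad w k k) := by simp [divergence, grad]
  simp only [evalAt_stress, h]
  rcases hd with rfl | rfl
  · simp [Fin.sum_univ_two]; ring
  · simp [Fin.sum_univ_three]; ring

namespace Mesh

variable (T : Mesh d)

/-- `‖τ_h(w)‖²` in `L²(Ω)`. -/
noncomputable def stressSq (w : T.BrokenField) : ℝ :=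
  ∑ K : T.elements, ∫ x in K.1, ∑ i, ∑ j, evalAt x (stress (w K) i j) ^ 2

/-- The weighted sum of the squared jumps. -/
noncomputable def jumpSq (w : T.BrokenField) : ℝ :=
  ∑ F : T.faces, T.faceIntegral F fun x => 1 / T.faceDiam F * ∑ i, T.jump w F x i ^ 2

/-- `‖∇_h · w‖²` in `L²(Ω)`. -/
noncomputable def divSq (w : T.BrokenField) : ℝ :=
  ∑ K : T.elements, ∫ x in K.1, evalAt x (divergence (w K)) ^ 2

lemma isFacet_plus (F : T.faces) : IsFacet (T.plus F).1 F.1 := T.plus_facet F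

lemma isPolytope_plus (F : T.faces) : IsPolytope (T.plus F).1 := T.isPolytope _ (T.plus F).2

lemma isPolytope_element (K : T.elements) : IsPolytope K.1 := T.isPolytope _ K.2

lemma integrable_face (F : T.faces) {f : Pt d → ℝ} (hf : Continuous f) :
    IntegrableOn f F.1 (Measure.euclideanHausdorffMeasure (d - 1)) :=
  (T.isFacet_plus F).integrableOn (T.isPolytope_plus F) hf

lemma integrable_element (K : T.elements) {f : Pt d → ℝ} (hf : Continuous f) :
    IntegrableOn f K.1 := (T.isPolytope_element K).integrableOn hf

lemma faceDiam_pos (hd : 2 ≤ d) (F : T.faces) : 0 < T.faceDiam F := by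
  obtain ⟨x, hx, y, hy, hxy⟩ := (T.isFacet_plus F).nontrivial hd
  exact (dist_pos.2 hxy).trans_le (Metric.dist_le_diam_of_mem
    ((T.isFacet_plus F).isCompact (T.isPolytope_plus F)).isBounded hx hy)

lemma faceDiam_le {F : T.faces} {K : T.elements} (h : IsFacet K.1 F.1) :
    T.faceDiam F ≤ Metric.diam K.1 :=
  Metric.diam_mono h.subset (T.isPolytope_element K).isCompact.isBounded

lemma faceIntegral_mono (F : T.faces) {f g : Pt d → ℝ} (hf : Continuous f) (hg : Continuous g)
    (h : ∀ x, f x ≤ g x) : T.faceIntegral F f ≤ T.faceIntegral F g :=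
  integral_mono (T.integrable_face F hf) (T.integrable_face F hg) h

lemma faceIntegral_add (F : T.faces) {f g : Pt d → ℝ} (hf : Continuous f) (hg : Continuous g) :
    T.faceIntegral F (fun x => f x + g x) = T.faceIntegral F f + T.faceIntegral F g :=
  integral_add (T.integrable_face F hf) (T.integrable_face F hg)

lemma faceIntegral_const_mul (F : T.faces) (a : ℝ) (f : Pt d → ℝ) :
    T.faceIntegral F (fun x => a * f x) = a * T.faceIntegral F f :=
  integral_const_mul a f

lemma faceIntegral_sum (F : T.faces) {ι : Type*} (s : Finset ι) {f : ι → Pt d → ℝ}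
    (hf : ∀ i, Continuous (f i)) :
    T.faceIntegral F (fun x => ∑ i ∈ s, f i x) = ∑ i ∈ s, T.faceIntegral F (f i) :=
  integral_finsetSum s fun i _ => T.integrable_face F (hf i)

lemma faceIntegral_nonneg (F : T.faces) {f : Pt d → ℝ} (h : ∀ x, 0 ≤ f x) :
    0 ≤ T.faceIntegral F f :=
  integral_nonneg h

lemma stressSq_nonneg (w : T.BrokenField) : 0 ≤ T.stressSq w :=
  Finset.sum_nonneg fun _ _ => integral_nonneg fun _ =>
    Finset.sum_nonneg fun _ _ => Finset.sum_nonneg fun _ _ => sq_nonneg _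

lemma jumpSq_nonneg (w : T.BrokenField) : 0 ≤ T.jumpSq w :=
  Finset.sum_nonneg fun F _ => T.faceIntegral_nonneg F fun _ =>
    mul_nonneg (one_div_nonneg.2 Metric.diam_nonneg) (Finset.sum_nonneg fun _ _ => sq_nonneg _)

lemma divSq_nonneg (w : T.BrokenField) : 0 ≤ T.divSq w :=
  Finset.sum_nonneg fun _ _ => integral_nonneg fun _ => sq_nonneg _

lemma normSym_eq (w : T.BrokenField) : T.normSym w = √(T.stressSq w + T.jumpSq w) := rfl

lemma normSym_sq (w : T.BrokenField) : T.normSym w ^ 2 = T.stressSq w + T.jumpSq w :=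
  Real.sq_sqrt (add_nonneg (T.stressSq_nonneg w) (T.jumpSq_nonneg w))

lemma divNorm_sq (w : T.BrokenField) : T.divNorm w ^ 2 = T.divSq w :=
  Real.sq_sqrt (T.divSq_nonneg w)

lemma normSymSup_eq (w : T.BrokenField) :
    T.normSymSup w = √(T.stressSq w + T.jumpSq w + 4 / 9 * (3 - (d : ℝ)) * T.divSq w) := by
  rw [normSymSup, normSym_sq, divNorm_sq]

lemma normSymSup_sq (hd : d ≤ 3) (w : T.BrokenField) :
    T.normSymSup w ^ 2 = T.stressSq w + T.jumpSq w + 4 / 9 * (3 - (d : ℝ)) * T.divSq w := by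
  have h3 : (0 : ℝ) ≤ 3 - d := by
    have : (d : ℝ) ≤ 3 := by exact_mod_cast hd
    linarith
  rw [normSymSup_eq, Real.sq_sqrt]
  have := T.stressSq_nonneg w
  have := T.jumpSq_nonneg w
  have := T.divSq_nonneg w
  positivity

lemma faceDiam_mul_faceIntegral_stress_le {K : T.elements} {F : T.faces} (hd : 2 ≤ d) {m : ℕ} {c : ℝ}
    (hc : T.traceConst m ≤ c) (hF : IsFacet K.1 F.1) {w : PolyField d}
    (hw : ∀ i, (w i).totalDegree ≤ m) :
    T.faceDiam F * T.faceIntegral F (fun x => ∑ i, ∑ j, evalAt x (stress w i j) ^ 2) ≤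
      c ^ 2 * ∫ x in K.1, ∑ i, ∑ j, evalAt x (stress w i j) ^ 2 := by
  have h0 := T.faceIntegral_nonneg F (f := fun x => ∑ i, ∑ j, evalAt x (stress w i j) ^ 2)
    fun x => Finset.sum_nonneg fun i _ => Finset.sum_nonneg fun j _ => sq_nonneg _
  refine (mul_le_mul_of_nonneg_right (T.faceDiam_le hF) h0).trans ?_
  rw [T.faceIntegral_sum F Finset.univ (fun i => by fun_prop),
    integral_finsetSum _ (fun i _ => T.integrable_element K (by fun_prop)), Finset.mul_sum,
    Finset.mul_sum]
  refine Finset.sum_le_sum fun i _ => ?_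
  rw [T.faceIntegral_sum F Finset.univ (fun i => by fun_prop),
    integral_finsetSum _ (fun i _ => T.integrable_element K (by fun_prop)), Finset.mul_sum,
    Finset.mul_sum]
  exact Finset.sum_le_sum fun j _ =>
    T.trace_inequality hd hc K F hF (totalDegree_stress_le hw i j)

/-- Cauchy–Schwarz bounds the square of a mean by the mean of the squares, here weakened to their
sum; on a boundary face nothing is lost. -/
lemma avgStress_sq_le (w : T.BrokenField) (F : T.faces) (x : Pt d) (i j : Fin d) :
    T.avgStress w F x i j ^ 2 ≤ ∑ K ∈ T.adj F, evalAt x (stress (w K) i j) ^ 2 := by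
  unfold avgStress
  set S := ∑ K ∈ T.adj F, evalAt x (stress (w K) i j) ^ 2
  have hS : 0 ≤ S := Finset.sum_nonneg fun _ _ => sq_nonneg _
  have h := sq_sum_le_card_mul_sum_sq (s := T.adj F) (f := fun K => evalAt x (stress (w K) i j))
  rcases Nat.eq_zero_or_pos (T.adj F).card with h0 | h0
  · simp [h0, hS]
  have h1 : (1 : ℝ) ≤ (T.adj F).card := by exact_mod_cast h0
  rw [mul_pow, inv_pow, inv_mul_le_iff₀ (by positivity)]
  refine h.trans ?_
  gcongr
  nlinarith

lemma young_face (hd : 2 ≤ d) (w : T.BrokenField) (F : T.faces) {θ : ℝ} (hθ : 0 < θ) (x : Pt d) :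
    2 * ∑ i, T.jump w F x i * ∑ j, T.avgStress w F x i j * T.normal F j ≤
      θ * (1 / T.faceDiam F * ∑ i, T.jump w F x i ^ 2) +
        T.faceDiam F / θ * ∑ K ∈ T.adj F, ∑ i, ∑ j, evalAt x (stress (w K) i j) ^ 2 := by
  have hh := T.faceDiam_pos hd F
  set h := T.faceDiam F
  have hn : ∑ j, T.normal F j ^ 2 = 1 := by
    have := EuclideanSpace.real_norm_sq_eq (T.normal F)
    rw [← this, T.norm_normal F, one_pow]
  have hA : ∑ i, (∑ j, T.avgStress w F x i j * T.normal F j) ^ 2 ≤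
      ∑ K ∈ T.adj F, ∑ i, ∑ j, evalAt x (stress (w K) i j) ^ 2 := by
    rw [Finset.sum_comm]
    refine Finset.sum_le_sum fun i _ => ?_
    refine (Finset.sum_mul_sq_le_sq_mul_sq _ _ _).trans ?_
    rw [hn, mul_one, Finset.sum_comm]
    exact Finset.sum_le_sum fun j _ => T.avgStress_sq_le w F x i j
  have hy : ∀ a b : ℝ, 2 * (a * b) ≤ θ * (1 / h * a ^ 2) + h / θ * b ^ 2 := by
    intro a b
    -- Young's inequality by completing the square; the weight `h` matches the scaling of the trace
    -- inequality.
    have : θ * (1 / h * a ^ 2) + h / θ * b ^ 2 - 2 * (a * b) = (θ * a - h * b) ^ 2 / (h * θ) := by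
      field_simp; ring
    have h2 : 0 ≤ (θ * a - h * b) ^ 2 / (h * θ) := by positivity
    linarith
  calc _ ≤ ∑ i, (θ * (1 / h * T.jump w F x i ^ 2) +
        h / θ * (∑ j, T.avgStress w F x i j * T.normal F j) ^ 2) := by
        rw [Finset.mul_sum]
        exact Finset.sum_le_sum fun i _ => hy _ _
    _ = θ * (1 / h * ∑ i, T.jump w F x i ^ 2) +
        h / θ * ∑ i, (∑ j, T.avgStress w F x i j * T.normal F j) ^ 2 := by
        rw [Finset.sum_add_distrib, Finset.mul_sum, Finset.mul_sum, Finset.mul_sum]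
    _ ≤ _ := by gcongr

/-- Double counting: after exchanging the sums, each element appears once per facet. -/
lemma sum_adj_le {N : ℕ} (hN : T.maxFaces ≤ N) {f : T.elements → ℝ} (hf : ∀ K, 0 ≤ f K) :
    ∑ F : T.faces, ∑ K ∈ T.adj F, f K ≤ N * ∑ K, f K := by
  classical
  have h1 : ∑ F : T.faces, ∑ K ∈ T.adj F, f K =
      ∑ K : T.elements, ∑ F ∈ Finset.univ.filter (fun F : T.faces => IsFacet K.1 F.1), f K :=
    Finset.sum_comm' fun F K => by simp [adj]
  rw [h1, Finset.mul_sum]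
  refine Finset.sum_le_sum fun K _ => ?_
  rw [Finset.sum_const, nsmul_eq_mul]
  refine mul_le_mul_of_nonneg_right ?_ (hf K)
  norm_cast
  refine le_trans ?_ hN
  unfold maxFaces
  refine le_trans ?_ (Finset.le_sup (f := fun K => (T.faces.filter fun F => IsFacet K F).card) K.2)
  refine Finset.card_le_card_of_injOn Subtype.val (fun F hF => ?_) Subtype.val_injective.injOn
  simpa using hF

lemma two_mul_consistencyTerm_le (hd : 2 ≤ d) {m : ℕ} {c : ℝ} {N : ℕ} (hc : T.traceConst m ≤ c)
    (hN : T.maxFaces ≤ N) {w : T.BrokenField} (hw : ∀ K i, (w K i).totalDegree ≤ m) {θ : ℝ}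
    (hθ : 0 < θ) :
    2 * T.consistencyTerm w w ≤ θ * T.jumpSq w + c ^ 2 * N / θ * T.stressSq w := by
  have hF (F : T.faces) : 2 * T.faceIntegral F (fun x =>
      ∑ i, T.jump w F x i * ∑ j, T.avgStress w F x i j * T.normal F j) ≤
      θ * T.faceIntegral F (fun x => 1 / T.faceDiam F * ∑ i, T.jump w F x i ^ 2) +
      c ^ 2 / θ * ∑ K ∈ T.adj F, ∫ x in K.1, ∑ i, ∑ j, evalAt x (stress (w K) i j) ^ 2 := by
    rw [← faceIntegral_const_mul, ← faceIntegral_const_mul]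
    refine (T.faceIntegral_mono F (by fun_prop) (by fun_prop)
      (fun x => T.young_face hd w F hθ x)).trans ?_
    rw [faceIntegral_add _ _ (by fun_prop) (by fun_prop)]
    gcongr
    rw [faceIntegral_const_mul, T.faceIntegral_sum F _ (fun i => by fun_prop), div_mul_eq_mul_div,
      div_mul_eq_mul_div, Finset.mul_sum, Finset.mul_sum]
    refine div_le_div_of_nonneg_right (Finset.sum_le_sum fun K hK => ?_) hθ.le
    exact T.faceDiam_mul_faceIntegral_stress_le hd hc (by simpa [adj] using hK) (hw K)
  unfold consistencyTerm jumpSq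
  rw [Finset.mul_sum]
  refine (Finset.sum_le_sum fun F _ => hF F).trans ?_
  rw [Finset.sum_add_distrib, ← Finset.mul_sum, ← Finset.mul_sum]
  refine add_le_add_right ?_ _
  have := T.sum_adj_le hN (f := fun K => ∫ x in K.1, ∑ i, ∑ j, evalAt x (stress (w K) i j) ^ 2)
    fun K => integral_nonneg fun _ =>
      Finset.sum_nonneg fun _ _ => Finset.sum_nonneg fun _ _ => sq_nonneg _
  calc _ ≤ c ^ 2 / θ * (N * T.stressSq w) := by gcongr; exact this
    _ = _ := by ring

lemma viscousForm_self (hd : d = 2 ∨ d = 3) (η : ℝ) (w : T.BrokenField) :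
    T.viscousForm η w w = 1 / 2 * T.stressSq w + 2 / 9 * (3 - (d : ℝ)) * T.divSq w
      - 2 * T.consistencyTerm w w + η * T.jumpSq w := by
  have h1 : ∑ K : T.elements, ∫ x in K.1,
      ∑ i, ∑ j, evalAt x (stress (w K) i j) * evalAt x (grad (w K) i j) =
      1 / 2 * T.stressSq w + 2 / 9 * (3 - (d : ℝ)) * T.divSq w := by
    rw [stressSq, divSq, Finset.mul_sum, Finset.mul_sum, ← Finset.sum_add_distrib]
    refine Finset.sum_congr rfl fun K _ => ?_
    simp only [stress_inner_grad hd]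
    rw [integral_add (T.integrable_element K (by fun_prop)) (T.integrable_element K (by fun_prop)),
      integral_const_mul, integral_const_mul]
  have h2 : (∑ F : T.faces, T.faceIntegral F fun x =>
      η / T.faceDiam F * ∑ i, T.jump w F x i * T.jump w F x i) = η * T.jumpSq w := by
    rw [jumpSq, Finset.mul_sum]
    refine Finset.sum_congr rfl fun F _ => ?_
    rw [← faceIntegral_const_mul]
    congr 1
    ext x
    simp only [pow_two]
    ring
  rw [viscousForm, h1, h2]
  ring

end Mesh

lemma exists_coercivity_const (hd : d = 2 ∨ d = 3) (m : ℕ) (c : ℝ) (N : ℕ) (η : ℝ)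
    (hη : 2 * c ^ 2 * (N : ℝ) < η) :
    ∃ C : ℝ, 0 < C ∧ ∀ T : Mesh d, T.traceConst m ≤ c → T.maxFaces ≤ N →
      ∀ w : T.BrokenField, (∀ K i, (w K i).totalDegree ≤ m) →
        C * T.normSymSup w ^ 2 ≤ T.viscousForm η w w := by
  have h0 : 0 ≤ 2 * c ^ 2 * (N : ℝ) := by positivity
  -- The midpoint of the admissible interval `(2 c² N, η)`: the lower end keeps part of the stress
  -- term, the upper end part of the jump term.
  set θ := (η + 2 * c ^ 2 * N) / 2 with hθdef
  have hθ : 0 < θ := by rw [hθdef]; linarith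
  have hθη : θ < η := by rw [hθdef]; linarith
  have hθ2 : c ^ 2 * N / θ < 1 / 2 := by
    rw [div_lt_iff₀ hθ, hθdef]; linarith
  have hq : 0 ≤ c ^ 2 * N / θ := by positivity
  set q := c ^ 2 * N / θ
  refine ⟨min (1 / 2 - q) (η - θ), lt_min (by linarith) (by linarith), fun T hc hN w hw => ?_⟩
  have hd2 : 2 ≤ d := by omega
  have hd3 : d ≤ 3 := by omega
  have h3 : (0 : ℝ) ≤ 3 - d := by
    have : (d : ℝ) ≤ 3 := by exact_mod_cast hd3
    linarith
  rw [T.normSymSup_sq hd3, T.viscousForm_self hd]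
  have hcons := T.two_mul_consistencyTerm_le hd2 hc hN hw hθ
  set C := min (1 / 2 - q) (η - θ)
  have hC1 : C ≤ 1 / 2 - q := min_le_left _ _
  have hC2 : C ≤ η - θ := min_le_right _ _
  have e1 := mul_le_mul_of_nonneg_right hC1 (T.stressSq_nonneg w)
  have e2 := mul_le_mul_of_nonneg_right hC2 (T.jumpSq_nonneg w)
  -- The divergence term is not touched by absorption: its coefficient `2/9` in the form is half the
  -- `4/9` of the norm, and `C ≤ 1/2`.
  have e3 : C * (4 / 9 * (3 - (d : ℝ)) * T.divSq w) ≤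
      1 / 2 * (4 / 9 * (3 - (d : ℝ)) * T.divSq w) := by
    have := T.divSq_nonneg w
    exact mul_le_mul_of_nonneg_right (by linarith) (by positivity)
  linarith

/-! ### Rigidity of fields with zero viscous stress. -/

section Rigidity

variable {d : ℕ}

/-- The commutator of two derivations is a derivation, and this one kills every variable. -/
lemma pderiv_pderiv_comm (i j : Fin d) (p : MvPolynomial (Fin d) ℝ) :
    MvPolynomial.pderiv i (MvPolynomial.pderiv j p) =
      MvPolynomial.pderiv j (MvPolynomial.pderiv i p) := by
  have h : ⁅(MvPolynomial.pderiv i : Derivation ℝ (MvPolynomial (Fin d) ℝ) (MvPolynomial (Fin d) ℝ)),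
      (MvPolynomial.pderiv j : Derivation ℝ (MvPolynomial (Fin d) ℝ) (MvPolynomial (Fin d) ℝ))⁆
      = 0 := by
    refine MvPolynomial.derivation_ext fun k => ?_
    simp [Derivation.commutator_apply, MvPolynomial.pderiv_X, Pi.single_apply, apply_ite]
  have := congrArg (fun D => D p) h
  simpa [Derivation.commutator_apply, sub_eq_zero] using this

lemma stress_pderiv (w : PolyField d) (k i j : Fin d) :
    stress (fun i => MvPolynomial.pderiv k (w i)) i j = MvPolynomial.pderiv k (stress w i j) := by
  simp only [stress, grad, divergence, map_sub, map_add]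
  rw [pderiv_pderiv_comm j k, pderiv_pderiv_comm i k]
  congr 1
  split_ifs
  · simp only [MvPolynomial.pderiv_C_mul, map_sum]
    simp only [pderiv_pderiv_comm _ k]
  · simp

/-- A rank-one matrix `g ⊗ n` with vanishing viscous stress is zero. -/
lemma eq_zero_of_rankOne_stress {g n : Fin d → ℝ} (hn : ∑ j, n j ^ 2 = 1)
    (h : ∀ i j, g i * n j + g j * n i - (if i = j then 2 / 3 * ∑ k, g k * n k else 0) = 0) :
    g = 0 := by
  obtain ⟨s, hs⟩ : ∃ s, s = ∑ k, g k * n k := ⟨_, rfl⟩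
  rw [← hs] at h
  -- Contraction with `n`, where `s = g · n`; a second contraction gives `4/3 s = 0`.
  have h1 : ∀ i, g i + s * n i - 2 / 3 * s * n i = 0 := by
    intro i
    have := Finset.sum_eq_zero (s := Finset.univ) fun j _ =>
      show (g i * n j + g j * n i - (if i = j then 2 / 3 * s else 0)) * n j = 0 by
        rw [h i j, zero_mul]
    have e : ∑ j, (g i * n j + g j * n i - (if i = j then 2 / 3 * s else 0)) * n j =
        g i * ∑ j, n j ^ 2 + s * n i - 2 / 3 * s * n i := by
      conv_rhs => enter [1, 2]; rw [hs]
      rw [Finset.sum_mul, Finset.mul_sum]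
      simp only [sub_mul, add_mul, Finset.sum_sub_distrib, Finset.sum_add_distrib, ite_mul,
        zero_mul, Finset.sum_ite_eq, Finset.mem_univ, if_true]
      congr 2
      · exact Finset.sum_congr rfl fun j _ => by ring
      · exact Finset.sum_congr rfl fun j _ => by ring
    rw [e, hn, mul_one] at this
    exact this
  have h2 : s = 0 := by
    have := Finset.sum_eq_zero (s := Finset.univ) fun i _ =>
      show (g i + s * n i - 2 / 3 * s * n i) * n i = 0 by rw [h1 i, zero_mul]
    have e : ∑ i, (g i + s * n i - 2 / 3 * s * n i) * n i =
        s + 1 / 3 * s * ∑ i, n i ^ 2 := by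
      rw [Finset.mul_sum]
      conv_rhs => enter [1]; rw [hs]
      rw [← Finset.sum_add_distrib]
      exact Finset.sum_congr rfl fun j _ => by ring
    rw [e, hn] at this
    linarith
  ext i
  simpa [h2] using h1 i

/-- If a polynomial field with zero viscous stress vanishes on a hyperplane, so does its
gradient. -/
lemma grad_eq_zero_on_hyperplane {w : PolyField d} (hw : ∀ i j, stress w i j = 0) {n x₀ : Pt d}
    (hn : ‖n‖ = 1) (h : ∀ v, ⟪n, v⟫ = 0 → ∀ i, evalAt (x₀ + v) (w i) = 0) {v : Pt d}
    (hv : ⟪n, v⟫ = 0) (i j : Fin d) : evalAt (x₀ + v) (grad w i j) = 0 := by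
  set x := x₀ + v
  have htan : ∀ u : Pt d, ⟪n, u⟫ = 0 → ∀ i, ∑ j, evalAt x (grad w i j) * u j = 0 := by
    intro u hu i
    have h1 := hasDerivAt_evalAt_line (w i) x u
    have h2 : (fun t : ℝ => evalAt (x + t • u) (w i)) = fun _ => 0 := by
      ext t
      rw [show x + t • u = x₀ + (v + t • u) by simp only [x, add_assoc]]
      exact h _ (by rw [inner_add_right, inner_smul_right, hv, hu, mul_zero, add_zero]) i
    rw [h2] at h1
    exact h1.unique (hasDerivAt_const _ _)
  set g : Fin d → ℝ := fun i => ∑ j, evalAt x (grad w i j) * n j with hg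
  have hG : ∀ i j, evalAt x (grad w i j) = g i * n j := by
    intro i j
    have hin : ⟪n, EuclideanSpace.single j (1 : ℝ)⟫ = n j := by
      rw [EuclideanSpace.inner_single_right]; simp
    -- The tangential part of the `j`-th basis vector: only the normal derivative `g` survives, so
    -- the gradient is `g ⊗ n`.
    have h1 := htan (EuclideanSpace.single j (1 : ℝ) - n j • n) (by
      rw [inner_sub_right, inner_smul_right, real_inner_self_eq_norm_sq, hn, hin]; ring) i
    simp only [PiLp.sub_apply, PiLp.smul_apply, smul_eq_mul, mul_sub, Finset.sum_sub_distrib] at h1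
    have h2 : ∑ k, evalAt x (grad w i k) * (EuclideanSpace.single j (1 : ℝ) : Pt d) k =
        evalAt x (grad w i j) := by
      simp
    have h3 : ∑ k, evalAt x (grad w i k) * (n j * n k) = g i * n j := by
      rw [hg, Finset.sum_mul]
      exact Finset.sum_congr rfl fun k _ => by ring
    linarith
  have hn' : ∑ j, n j ^ 2 = 1 := by
    rw [← EuclideanSpace.real_norm_sq_eq, hn, one_pow]
  have hg0 : g = 0 := by
    refine eq_zero_of_rankOne_stress hn' fun i j => ?_
    have := evalAt_stress x w i j
    rw [hw i j, evalAt_zero] at this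
    simp only [hG] at this
    exact this.symm
  rw [hG, hg0]
  simp

/-- A polynomial field with zero viscous stress that vanishes on a hyperplane is zero. -/
lemma eq_zero_of_stress_eq_zero {w : PolyField d} (hw : ∀ i j, stress w i j = 0) {n x₀ : Pt d}
    (hn : ‖n‖ = 1) (h : ∀ v, ⟪n, v⟫ = 0 → ∀ i, evalAt (x₀ + v) (w i) = 0) : w = 0 := by
  obtain ⟨N, hN⟩ : ∃ N, ∀ i, (w i).totalDegree ≤ N :=
    ⟨Finset.univ.sup fun i => (w i).totalDegree, fun i =>
      Finset.le_sup (f := fun i => (w i).totalDegree) (Finset.mem_univ i)⟩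
  have hx₀ : ∀ {w : PolyField d}, (∀ v, ⟪n, v⟫ = 0 → ∀ i, evalAt (x₀ + v) (w i) = 0) →
      ∀ i, evalAt x₀ (w i) = 0 := fun h i => by simpa using h 0 (inner_zero_right _) i
  induction N generalizing w with
  | zero =>
    ext1 i
    have h1 := hx₀ h i
    rw [MvPolynomial.totalDegree_eq_zero_iff_eq_C.1 (Nat.le_zero.1 (hN i))] at h1 ⊢
    simp only [evalAt, MvPolynomial.eval_C] at h1
    simp [h1]
  | succ N ih =>
    -- Each partial derivative of `w` has zero stress, vanishes on the same hyperplane and has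
    -- smaller degree, so the induction hypothesis applies. Then `w` is constant, with value `0` at
    -- `x₀`.
    have hpd : ∀ k i, MvPolynomial.pderiv k (w i) = 0 := by
      intro k i
      refine congrFun (ih (w := fun i => MvPolynomial.pderiv k (w i)) (fun i j => ?_)
        (fun v hv i => grad_eq_zero_on_hyperplane hw hn h hv i k) fun i => ?_) i
      · rw [stress_pderiv, hw, map_zero]
      · have := totalDegree_pderiv_le k (w i)
        have := hN i
        omega
    ext1 i
    refine MvPolynomial.funext fun y => ?_
    have hc := is_const_of_fderiv_eq_zero (𝕜 := ℝ) (f := fun x : Pt d => evalAt x (w i))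
      (fun x => (hasFDerivAt_evalAt (w i) x).differentiableAt)
      (fun x => by rw [(hasFDerivAt_evalAt (w i) x).fderiv]; simp [hpd])
      (WithLp.toLp 2 y) x₀
    simp only [hx₀ h i] at hc
    simpa [evalAt] using hc

end Rigidity

/-! ### Convex geometry: a facet that belongs to only one polytope of a family. -/

section Polytopes

variable {d : ℕ}

lemma apply_eq_of_mem_affineSpan {A : Set (Pt d)} {l : Pt d →L[ℝ] ℝ} {c : ℝ}
    (h : ∀ x ∈ A, l x = c) {x : Pt d} (hx : x ∈ affineSpan ℝ A) : l x = c := by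
  have hle : affineSpan ℝ A ≤ (affineSpan ℝ {c}).comap l.toLinearMap.toAffineMap := by
    rw [affineSpan_le]
    intro y hy
    simp [h y hy]
  simpa using hle hx

/-- Near a point in the relative interior of a simplex of dimension `d - 1`, a convex set that
contains the simplex and a point on one side of its hyperplane contains everything on that side. -/
lemma eventually_mem_of_le {ι : Type*} [Fintype ι] {C : Set (Pt d)} (hC : Convex ℝ C)
    {t : ι → Pt d} (ht : AffineIndependent ℝ t) (hcard : Fintype.card ι = d) (htC : range t ⊆ C)
    {l : Pt d →L[ℝ] ℝ} {c : ℝ} (hl : ∀ i, l (t i) = c) {w : ι → ℝ} (hw : ∀ i, 0 < w i)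
    (hw1 : ∑ i, w i = 1) {x₀ : Pt d} (hx₀ : x₀ ∈ C) (hlx : l x₀ < c) :
    ∀ᶠ y in nhds (∑ i, w i • t i), l y ≤ c → y ∈ C := by
  classical
  -- Adding the apex `x₀` off the hyperplane yields a full-dimensional simplex inside `C`.
  let p : Option ι → Pt d := fun o => o.elim x₀ t
  have hind : AffineIndependent ℝ p := by
    refine AffineIndependent.affineIndependent_of_notMem_span (i := none) ?_ ?_
    · let e : {y : Option ι // y ≠ none} ↪ ι :=
        ⟨fun y => y.1.get (Option.isSome_iff_ne_none.2 y.2), fun y z h => by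
          apply Subtype.ext
          rw [← Option.some_get (Option.isSome_iff_ne_none.2 y.2),
            ← Option.some_get (Option.isSome_iff_ne_none.2 z.2)]
          exact congrArg some h⟩
      have he : (fun x : {y : Option ι // y ≠ none} => p x) = t ∘ e := by
        ext1 ⟨y, hy⟩
        cases y with
        | none => exact absurd rfl hy
        | some i => rfl
      rw [he]
      exact ht.comp_embedding e
    · intro hmem
      refine hlx.ne (apply_eq_of_mem_affineSpan ?_ hmem)
      rintro _ ⟨o, ho, rfl⟩
      cases o with
      | none => exact absurd rfl ho
      | some i => exact hl i
  have htop : affineSpan ℝ (range p) = ⊤ := by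
    rw [hind.affineSpan_eq_top_iff_card_eq_finrank_add_one]
    simp [hcard]
  let b : AffineBasis (Option ι) ℝ (Pt d) := ⟨p, hind, htop⟩
  have hb : ⇑b = p := rfl
  have hz : ∀ i, b.coord (some i) (∑ i, w i • t i) = w i := by
    intro i
    let w' : Option ι → ℝ := fun o => o.elim 0 w
    have hw' : ∑ o, w' o = 1 := by rw [Fintype.sum_option]; simpa [w'] using hw1
    have h := b.coord_apply_combination_of_mem (Finset.mem_univ (some i)) hw'
    rw [Finset.affineCombination_eq_linear_combination _ _ _ hw', Fintype.sum_option] at h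
    simpa [w', hb, p] using h
  -- The apex coordinate measures the distance to the hyperplane, so its sign is the side condition;
  -- the other coordinates stay positive near the given point.
  have hnone : ∀ y, b.coord none y * (c - l x₀) = c - l y := by
    intro y
    have h1 := b.sum_coord_apply_eq_one y
    have h2 := congrArg l (b.linear_combination_coord_eq_self y)
    rw [Fintype.sum_option] at h1
    simp only [map_add, map_sum, map_smul, smul_eq_mul, Fintype.sum_option, hb, p, Option.elim_some,
      Option.elim_none, hl, ← Finset.sum_mul] at h2
    rw [← eq_sub_iff_add_eq'] at h1
    rw [h1] at h2
    linarith
  have hpos : ∀ᶠ y in nhds (∑ i, w i • t i), ∀ i, 0 < b.coord (some i) y := by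
    rw [Filter.eventually_all]
    intro i
    refine (continuous_barycentric_coord b (some i)).continuousAt.eventually_const_lt ?_
    rw [hz]
    exact hw i
  filter_upwards [hpos] with y hy hly
  have hmem : y ∈ convexHull ℝ (range b) := by
    rw [b.convexHull_eq_nonneg_coord]
    intro o
    cases o with
    | none =>
      have := hnone y
      by_contra hneg
      nlinarith
    | some i => exact (hy i).le
  refine convexHull_min ?_ hC hmem
  rintro _ ⟨o, rfl⟩
  cases o with
  | none => exact hx₀
  | some i => exact htC ⟨i, rfl⟩

lemma finrank_ker_add_one {l : Pt d →L[ℝ] ℝ} (hl : l ≠ 0) :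
    Module.finrank ℝ (LinearMap.ker l.toLinearMap) + 1 = d := by
  have := Module.Dual.finrank_ker_add_one_of_ne_zero (f := l.toLinearMap)
    (fun h => hl (ContinuousLinearMap.ext fun x => LinearMap.congr_fun h x))
  simpa using this

/-- A functional that is constant near an interior point has zero derivative there, but its
derivative is itself. -/
lemma exists_apply_ne {C : Set (Pt d)} (hC : (interior C).Nonempty) {l : Pt d →L[ℝ] ℝ}
    (hl : l ≠ 0) (c : ℝ) : ∃ x ∈ C, l x ≠ c := by
  by_contra! h
  obtain ⟨x, hx⟩ := hC
  refine hl ?_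
  have h1 : HasFDerivAt (fun _ : Pt d => c) l x :=
    l.hasFDerivAt.congr_of_eventuallyEq
      (Filter.eventuallyEq_of_mem (mem_interior_iff_mem_nhds.1 hx) fun y hy => (h y hy).symm)
  exact h1.unique (hasFDerivAt_const c x)

/-- A boundary point of a polytope that lies on no flat of dimension at most `d - 2` spanned by
vertices is in the relative interior of a simplex spanning a facet. -/
lemma exists_facet_of_mem_boundary {s : Finset (Pt d)} {z : Pt d}
    (hint : (interior (convexHull ℝ (s : Set (Pt d)))).Nonempty)
    (hz : z ∈ convexHull ℝ (s : Set (Pt d))) (hzi : z ∉ interior (convexHull ℝ (s : Set (Pt d))))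
    (hZ : ∀ t ⊆ s, Module.finrank ℝ (vectorSpan ℝ (t : Set (Pt d))) + 2 ≤ d →
      z ∉ affineSpan ℝ (t : Set (Pt d))) :
    ∃ (l : Pt d →L[ℝ] ℝ) (F : Set (Pt d)) (ι : Type) (_ : Fintype ι) (t : ι → Pt d) (w : ι → ℝ),
      l ≠ 0 ∧ (∀ y ∈ convexHull ℝ (s : Set (Pt d)), l y ≤ l z) ∧
      IsFacet (convexHull ℝ (s : Set (Pt d))) F ∧ range t ⊆ F ∧ AffineIndependent ℝ t ∧
      Fintype.card ι = d ∧ (∀ i, l (t i) = l z) ∧ (∀ i, 0 < w i) ∧ ∑ i, w i = 1 ∧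
      ∑ i, w i • t i = z := by
  classical
  set K := convexHull ℝ (s : Set (Pt d)) with hK
  have hKc : Convex ℝ K := convex_convexHull ℝ _
  obtain ⟨l, hl⟩ := geometric_hahn_banach_open_point hKc.interior isOpen_interior hzi
  have hl0 : l ≠ 0 := by
    rintro rfl
    obtain ⟨x, hx⟩ := hint
    simpa using hl x hx
  have hle : ∀ y ∈ K, l y ≤ l z := by
    intro y hy
    have hsub : closure (interior K) ⊆ {y | l y ≤ l z} :=
      closure_minimal (fun y hy => (hl y hy).le) (isClosed_le l.continuous continuous_const)
    refine hsub ?_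
    rw [hKc.closure_interior_eq_closure_of_nonempty_interior hint]
    exact subset_closure hy
  obtain ⟨ι, _, t, w, hts, hti, hw, hw1, hwz⟩ := eq_pos_convex_span_of_mem_convexHull hz
  have htK : ∀ i, t i ∈ K := fun i => subset_convexHull ℝ _ (hts ⟨i, rfl⟩)
  -- A convex combination with positive weights attains the maximum of `l` only if each of its
  -- points does.
  have htl : ∀ i, l (t i) = l z := by
    have hsum : ∑ i, w i * (l z - l (t i)) = 0 := by
      simp only [mul_sub, Finset.sum_sub_distrib, ← Finset.sum_mul, hw1, one_mul]
      rw [sub_eq_zero]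
      conv_lhs => rw [← hwz]
      simp
    intro i
    have := (Finset.sum_eq_zero_iff_of_nonneg fun i _ =>
      mul_nonneg (hw i).le (sub_nonneg.2 (hle _ (htK i)))).1 hsum i (Finset.mem_univ i)
    rcases mul_eq_zero.1 this with h | h
    · exact absurd h (hw i).ne'
    · linarith
  have hker : ∀ A : Set (Pt d), (∀ x ∈ A, l x = l z) →
      vectorSpan ℝ A ≤ LinearMap.ker l.toLinearMap := by
    intro A hA
    rw [vectorSpan_def, Submodule.span_le]
    rintro _ ⟨x, hx, y, hy, rfl⟩
    change l (x - y) = 0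
    rw [map_sub, hA x hx, hA y hy, sub_self]
  have hkd := finrank_ker_add_one hl0
  have hne : Nonempty ι := by
    by_contra hemp
    rw [not_nonempty_iff] at hemp
    simp at hw1
  have hfin := hti.finrank_vectorSpan_add_one
  have hle1 := Submodule.finrank_mono (hker (range t) (by rintro _ ⟨i, rfl⟩; exact htl i))
  -- Affinely independent points on the supporting hyperplane number at most `d`; with fewer, `z`
  -- would lie on a flat excluded by `hZ`.
  have hcard : Fintype.card ι = d := by
    by_contra hcard
    refine hZ (Finset.univ.image t) ?_ ?_ ?_
    · intro x hx
      obtain ⟨i, -, rfl⟩ := Finset.mem_image.1 hx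
      exact hts ⟨i, rfl⟩
    · rw [Finset.coe_image, Finset.coe_univ, image_univ]
      omega
    · rw [Finset.coe_image, Finset.coe_univ, image_univ]
      refine convexHull_subset_affineSpan _ ?_
      rw [← hwz]
      exact (convex_convexHull ℝ _).sum_mem (fun i _ => (hw i).le) hw1
        fun i _ => subset_convexHull ℝ _ ⟨i, rfl⟩
  let F := {x ∈ K | ∀ y ∈ K, l y ≤ l x}
  have hF : ∀ x ∈ F, l x = l z := fun x hx => le_antisymm (hle x hx.1) (hx.2 z hz)
  have htF : range t ⊆ F := by
    rintro _ ⟨i, rfl⟩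
    exact ⟨htK i, fun y hy => by rw [htl]; exact hle y hy⟩
  refine ⟨l, F, ULift.{0} ι, inferInstance, t ∘ ULift.down, w ∘ ULift.down, hl0, hle,
    ⟨fun _ => ⟨l, rfl⟩, ?_⟩, ?_, ?_, ?_, fun i => htl _, fun i => hw _, ?_, ?_⟩
  · have h1 := Submodule.finrank_mono (vectorSpan_mono ℝ htF)
    have h2 := Submodule.finrank_mono (hker F hF)
    omega
  · rintro _ ⟨i, rfl⟩
    exact htF ⟨_, rfl⟩
  · exact hti.comp_embedding Equiv.ulift.toEmbedding
  · simpa using hcard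
  · rw [← hw1]
    exact Equiv.ulift.sum_comp w
  · rw [← hwz]
    exact Equiv.ulift.sum_comp fun i => w i • t i

/-- If two polytopes with disjoint interiors share a facet, its generic points are interior to
their union. -/
lemma mem_interior_union {ι : Type*} [Fintype ι] {K K' : Set (Pt d)} (hK : IsPolytope K)
    (hK' : IsPolytope K') (hdisj : Disjoint (interior K) (interior K')) {t : ι → Pt d}
    (ht : AffineIndependent ℝ t) (hcard : Fintype.card ι = d) (htK : range t ⊆ K)
    (htK' : range t ⊆ K') {l : Pt d →L[ℝ] ℝ} (hl0 : l ≠ 0) {c : ℝ} (hl : ∀ i, l (t i) = c)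
    (hle : ∀ y ∈ K, l y ≤ c) {w : ι → ℝ} (hw : ∀ i, 0 < w i) (hw1 : ∑ i, w i = 1) :
    ∑ i, w i • t i ∈ interior (K ∪ K') := by
  obtain ⟨x₀, hx₀, hne₀⟩ := exists_apply_ne hK.2 hl0 c
  have hlt₀ : l x₀ < c := lt_of_le_of_ne (hle x₀ hx₀) hne₀
  have h1 := eventually_mem_of_le hK.convex ht hcard htK hl hw hw1 hx₀ hlt₀
  by_cases hex : ∃ x₁ ∈ K', c < l x₁
  · obtain ⟨x₁, hx₁, hlt₁⟩ := hex
    have h2 := eventually_mem_of_le (l := -l) (c := -c) hK'.convex ht hcard htK'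
      (fun i => by simp [hl]) hw hw1 hx₁ (by simpa using hlt₁)
    rw [mem_interior_iff_mem_nhds]
    filter_upwards [h1, h2] with y hy1 hy2
    rcases le_total (l y) c with h | h
    · exact Or.inl (hy1 h)
    · exact Or.inr (hy2 (by simpa using h))
  -- Were both polytopes on the same side, each would contain the half-neighbourhood of `z` there,
  -- and their interiors would meet.
  · push Not at hex
    obtain ⟨x₁, hx₁, hne₁⟩ := exists_apply_ne hK'.2 hl0 c
    have h2 := eventually_mem_of_le hK'.convex ht hcard htK' hl hw hw1 hx₁
      (lt_of_le_of_ne (hex x₁ hx₁) hne₁)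
    exfalso
    set z := ∑ i, w i • t i
    have hlz : l z = c := by
      simp only [z, map_sum, map_smul, hl, smul_eq_mul, ← Finset.sum_mul, hw1, one_mul]
    obtain ⟨U, hU, hUo, hzU⟩ := eventually_nhds_iff.1 (h1.and h2)
    have htend : Filter.Tendsto (fun ε : ℝ => z + ε • (x₀ - z)) (nhdsWithin 0 (Ioi 0)) (nhds z) := by
      have hc : Continuous fun ε : ℝ => z + ε • (x₀ - z) := by fun_prop
      have := hc.tendsto 0
      simp only [zero_smul, add_zero] at this
      exact this.mono_left nhdsWithin_le_nhds
    obtain ⟨ε, hεU, hε⟩ := ((htend.eventually (hUo.mem_nhds hzU)).and self_mem_nhdsWithin).exists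
    have hVo : IsOpen (U ∩ {y | l y < c}) := hUo.inter (isOpen_lt l.continuous continuous_const)
    have hmem : z + ε • (x₀ - z) ∈ U ∩ {y | l y < c} := by
      refine ⟨hεU, ?_⟩
      change l _ < c
      rw [map_add, map_smul, map_sub, hlz, smul_eq_mul]
      have : 0 < ε := hε
      nlinarith
    refine disjoint_left.1 hdisj (mem_interior.2 ⟨_, fun y hy => (hU y hy.1).1 hy.2.le, hVo, hmem⟩)
      (mem_interior.2 ⟨_, fun y hy => (hU y hy.1).2 hy.2.le, hVo, hmem⟩)

/-- Finitely many flats of dimension at most `d - 2` do not disconnect: from some point of a given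
open set the segment to `y` avoids all of them, except possibly at `y`. -/
lemma exists_segment_avoiding {κ : Type*} (I : Finset κ) (A : κ → Set (Pt d))
    (hA : ∀ k ∈ I, Module.finrank ℝ (vectorSpan ℝ (A k)) + 2 ≤ d) {V : Set (Pt d)}
    (hV : IsOpen V) (hne : V.Nonempty) (y : Pt d) :
    ∃ x ∈ V, ∀ z ∈ segment ℝ x y, z ≠ y → ∀ k ∈ I, z ∉ affineSpan ℝ (A k) := by
  -- Joining `y` to a flat of dimension at most `d - 2` gives one of dimension at most `d - 1`, a
  -- null set. A start point `x` outside these works: a hit `z ≠ y` would put `x`, on the line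
  -- through `y` and `z`, into such a flat.
  have hnull : volume (⋃ k ∈ I, (affineSpan ℝ (insert y (A k)) : Set (Pt d))) = 0 := by
    refine (measure_biUnion_null_iff I.countable_toSet).2 fun k hk => ?_
    refine Measure.addHaar_affineSubspace _ _ fun htop => ?_
    have h1 := finrank_vectorSpan_insert_le_set ℝ (A k) y
    rw [← direction_affineSpan, htop, AffineSubspace.direction_top, finrank_top,
      finrank_euclideanSpace_fin] at h1
    have := hA k hk
    omega
  have hpos : 0 < volume (V \ ⋃ k ∈ I, (affineSpan ℝ (insert y (A k)) : Set (Pt d))) := by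
    rw [measure_sdiff_null hnull]
    exact hV.measure_pos volume hne
  obtain ⟨x, hxV, hx⟩ := nonempty_of_measure_ne_zero hpos.ne'
  refine ⟨x, hxV, fun z hz hzy k hk hzk => hx ?_⟩
  rw [mem_iUnion₂]
  refine ⟨k, hk, ?_⟩
  have hzin : z ∈ affineSpan ℝ (insert y (A k)) :=
    affineSpan_mono ℝ (subset_insert _ _) hzk
  have hyin : y ∈ affineSpan ℝ (insert y (A k)) := subset_affineSpan ℝ _ (mem_insert _ _)
  rw [segment_symm, segment_eq_image_lineMap] at hz
  obtain ⟨s, -, rfl⟩ := hz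
  have hs : s ≠ 0 := by
    rintro rfl
    simp at hzy
  have hline := AffineMap.lineMap_mem s⁻¹ hyin hzin
  have hxe : AffineMap.lineMap y (AffineMap.lineMap y x s) s⁻¹ = x := by
    simp [AffineMap.lineMap_apply, smul_smul, inv_mul_cancel₀ hs]
  rw [hxe] at hline
  exact hline

/-- A finite nonempty family of non-overlapping polytopes has a facet that belongs to only one
of them. -/
lemma exists_facet_of_single (hd : 1 ≤ d) {S : Finset (Set (Pt d))} (hS : S.Nonempty)
    (hpoly : ∀ K ∈ S, IsPolytope K)
    (hdisj : ∀ K ∈ S, ∀ K' ∈ S, K ≠ K' → Disjoint (interior K) (interior K')) :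
    ∃ K ∈ S, ∃ F, IsFacet K F ∧ ∀ K' ∈ S, IsFacet K' F → K' = K := by
  classical
  choose! s hs using fun K hK => (hpoly K hK).1
  set U := ⋃ K ∈ S, K with hU
  have hUc : IsCompact U := S.isCompact_biUnion fun K hK => (hpoly K hK).isCompact
  obtain ⟨y, hy⟩ : ∃ y, y ∉ U := by
    by_contra! h
    have : Nontrivial (Pt d) := by
      have : Nonempty (Fin d) := ⟨⟨0, hd⟩⟩
      infer_instance
    have := NormedSpace.noncompactSpace ℝ (Pt d)
    exact noncompact_univ (Pt d) ((eq_univ_of_forall h) ▸ hUc)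
  obtain ⟨K₀, hK₀⟩ := hS
  let I : Finset (Finset (Pt d)) := (S.biUnion fun K => (s K).powerset).filter fun t =>
    Module.finrank ℝ (vectorSpan ℝ (t : Set (Pt d))) + 2 ≤ d
  obtain ⟨x, hx, havoid⟩ := exists_segment_avoiding I (fun t => (t : Set (Pt d)))
    (fun t ht => (Finset.mem_filter.1 ht).2) isOpen_interior (hpoly K₀ hK₀).2 y
  have hxU : x ∈ interior U := interior_mono (subset_biUnion_of_mem (u := fun K => K) hK₀) hx
  -- Without a boundary point on it, the segment would be disconnected by `interior U` and the
  -- complement of `U`.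
  obtain ⟨z, hzseg, hzU, hzi⟩ : ∃ z ∈ segment ℝ x y, z ∈ U ∧ z ∉ interior U := by
    by_contra! h
    obtain ⟨z, -, hz1, hz2⟩ := (convex_segment (𝕜 := ℝ) x y).isPreconnected (interior U) Uᶜ
      isOpen_interior hUc.isClosed.isOpen_compl
      (fun z hz => (em (z ∈ U)).imp (h z hz) id)
      ⟨x, left_mem_segment ℝ x y, hxU⟩ ⟨y, right_mem_segment ℝ x y, hy⟩
    exact hz2 (interior_subset hz1)
  have hzy : z ≠ y := fun h => hy (h ▸ hzU)
  obtain ⟨K, hK, hzK⟩ := mem_iUnion₂.1 hzU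
  have hKs := hs K hK
  have hzKi : z ∉ interior K := fun h =>
    hzi (interior_mono (subset_biUnion_of_mem (u := fun K => K) hK) h)
  obtain ⟨l, F, ι, _, t, w, hl0, hle, hF, htF, hti, hcard, hlt, hw, hw1, hwz⟩ :=
    exists_facet_of_mem_boundary (s := s K) (z := z) (hKs ▸ (hpoly K hK).2) (hKs ▸ hzK)
      (hKs ▸ hzKi) fun t ht hdim => havoid z hzseg hzy t
        (Finset.mem_filter.2 ⟨Finset.mem_biUnion.2 ⟨K, hK, Finset.mem_powerset.2 ht⟩, hdim⟩)
  rw [← hKs] at hF hle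
  refine ⟨K, hK, F, hF, fun K' hK' hF' => ?_⟩
  -- A second owner of `F` would make the generic point `z` interior to the union of the two, hence
  -- to `U`.
  by_contra hne
  have := mem_interior_union (hpoly K hK) (hpoly K' hK') (hdisj K hK K' hK' (Ne.symm hne)) hti
    hcard (htF.trans hF.subset) (htF.trans hF'.subset) hl0 hlt hle hw hw1
  rw [hwz] at this
  exact hzi (interior_mono (union_subset (subset_biUnion_of_mem (u := fun K => K) hK)
    (subset_biUnion_of_mem (u := fun K => K) hK')) this)

end Polytopes

variable {d : ℕ}

/-! ### The stronger norm as the seminorm of a positive semidefinite form. -/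

section Linearity

lemma stress_add (v w : PolyField d) (i j : Fin d) :
    stress (v + w) i j = stress v i j + stress w i j := by
  simp only [stress, grad, divergence, Pi.add_apply, map_add, Finset.sum_add_distrib, mul_add]
  split_ifs <;> ring

lemma stress_smul (a : ℝ) (w : PolyField d) (i j : Fin d) :
    stress (a • w) i j = a • stress w i j := by
  simp only [stress, grad, divergence, Pi.smul_apply, Derivation.map_smul, ← Finset.smul_sum,
    mul_smul_comm]
  split_ifs <;> module

lemma divergence_add (v w : PolyField d) : divergence (v + w) = divergence v + divergence w := by
  simp [divergence, Finset.sum_add_distrib]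

lemma divergence_smul (a : ℝ) (w : PolyField d) : divergence (a • w) = a • divergence w := by
  simp [divergence, Finset.smul_sum]

namespace Mesh

variable (T : Mesh d)

lemma jump_add (v w : T.BrokenField) (F : T.faces) (x : Pt d) (i : Fin d) :
    T.jump (v + w) F x i = T.jump v F x i + T.jump w F x i := by
  simp only [jump, Pi.add_apply, evalAt_add, Finset.sum_add_distrib]
  ring

lemma jump_smul (a : ℝ) (w : T.BrokenField) (F : T.faces) (x : Pt d) (i : Fin d) :
    T.jump (a • w) F x i = a * T.jump w F x i := by
  simp only [jump, Pi.smul_apply, evalAt_smul, ← Finset.mul_sum]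
  ring

/-- The symmetric bilinear form that induces the stronger norm. -/
noncomputable def supForm (v w : T.BrokenField) : ℝ :=
  (∑ K : T.elements, ∫ x in K.1,
      (∑ i, ∑ j, evalAt x (stress (v K) i j) * evalAt x (stress (w K) i j) +
        4 / 9 * (3 - (d : ℝ)) * (evalAt x (divergence (v K)) * evalAt x (divergence (w K))))) +
    ∑ F : T.faces, T.faceIntegral F fun x =>
      1 / T.faceDiam F * ∑ i, T.jump v F x i * T.jump w F x i

lemma supForm_self (w : T.BrokenField) :
    T.supForm w w = T.stressSq w + T.jumpSq w + 4 / 9 * (3 - (d : ℝ)) * T.divSq w := by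
  have h (K : T.elements) := integral_add
    (T.integrable_element K (f := fun x => ∑ i, ∑ j,
      evalAt x (stress (w K) i j) * evalAt x (stress (w K) i j)) (by fun_prop))
    (T.integrable_element K (f := fun x => 4 / 9 * (3 - (d : ℝ)) *
      (evalAt x (divergence (w K)) * evalAt x (divergence (w K)))) (by fun_prop))
  simp only [supForm, h, integral_const_mul, Finset.sum_add_distrib, ← Finset.mul_sum, stressSq,
    jumpSq, divSq, pow_two]
  ring

lemma supForm_comm (v w : T.BrokenField) : T.supForm v w = T.supForm w v := by
  simp only [supForm, mul_comm (evalAt _ (stress (v _) _ _)), mul_comm (evalAt _ (divergence (v _))),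
    mul_comm (T.jump v _ _ _)]

lemma supForm_add_left (u v w : T.BrokenField) :
    T.supForm (u + v) w = T.supForm u w + T.supForm v w := by
  have h1 (K : T.elements) := integral_add
    (T.integrable_element K (f := fun x =>
      ∑ i, ∑ j, evalAt x (stress (u K) i j) * evalAt x (stress (w K) i j) +
        4 / 9 * (3 - (d : ℝ)) * (evalAt x (divergence (u K)) * evalAt x (divergence (w K))))
      (by fun_prop))
    (T.integrable_element K (f := fun x =>
      ∑ i, ∑ j, evalAt x (stress (v K) i j) * evalAt x (stress (w K) i j) +
        4 / 9 * (3 - (d : ℝ)) * (evalAt x (divergence (v K)) * evalAt x (divergence (w K))))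
      (by fun_prop))
  have h2 (F : T.faces) := T.faceIntegral_add F
    (f := fun x => 1 / T.faceDiam F * ∑ i, T.jump u F x i * T.jump w F x i)
    (g := fun x => 1 / T.faceDiam F * ∑ i, T.jump v F x i * T.jump w F x i)
    (by fun_prop) (by fun_prop)
  rw [supForm, supForm, supForm, add_add_add_comm, ← Finset.sum_add_distrib,
    ← Finset.sum_add_distrib]
  simp only [← h1, ← h2, Pi.add_apply, stress_add, divergence_add, jump_add, evalAt_add, add_mul,
    mul_add, Finset.sum_add_distrib]
  congr 1
  exact Finset.sum_congr rfl fun K _ => by congr 1; ext x; ring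

lemma supForm_smul_left (a : ℝ) (v w : T.BrokenField) :
    T.supForm (a • v) w = a * T.supForm v w := by
  rw [supForm, supForm, mul_add, Finset.mul_sum, Finset.mul_sum]
  congr 1
  · refine Finset.sum_congr rfl fun K _ => ?_
    rw [← integral_const_mul]
    congr 1
    ext x
    simp only [Pi.smul_apply, stress_smul, divergence_smul, evalAt_smul, mul_assoc,
      ← Finset.mul_sum]
    ring
  · refine Finset.sum_congr rfl fun F _ => ?_
    rw [← faceIntegral_const_mul]
    congr 1
    ext x
    simp only [jump_smul, mul_assoc, ← Finset.mul_sum]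
    ring

lemma normSymSup_eq_sqrt (w : T.BrokenField) : T.normSymSup w = √(T.supForm w w) := by
  rw [normSymSup_eq, supForm_self]

lemma supForm_self_nonneg (hd : d ≤ 3) (w : T.BrokenField) : 0 ≤ T.supForm w w := by
  rw [supForm_self, ← T.normSymSup_sq hd]
  exact sq_nonneg _

lemma normSymSup_smul (a : ℝ) (w : T.BrokenField) :
    T.normSymSup (a • w) = |a| * T.normSymSup w := by
  rw [normSymSup_eq_sqrt, normSymSup_eq_sqrt, supForm_smul_left, supForm_comm, supForm_smul_left,
    ← mul_assoc, ← pow_two, Real.sqrt_mul (sq_nonneg a), Real.sqrt_sq_eq_abs]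

lemma normSymSup_add_le (hd : d ≤ 3) (v w : T.BrokenField) :
    T.normSymSup (v + w) ≤ T.normSymSup v + T.normSymSup w := by
  let core : PreInnerProductSpace.Core ℝ T.BrokenField :=
    { inner := T.supForm
      conj_inner_symm := fun v w => T.supForm_comm w v
      re_inner_nonneg := fun w => T.supForm_self_nonneg hd w
      add_left := T.supForm_add_left
      smul_left := fun v w a => T.supForm_smul_left a v w }
  simp only [normSymSup_eq_sqrt]
  exact @norm_add_le _
    (@InnerProductSpace.Core.toSeminormedAddCommGroup ℝ T.BrokenField _ _ _ core).toSeminormedAddGroup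
    v w

end Mesh

end Linearity

/-! ### Definiteness of the stronger norm. -/

section Definiteness

namespace Mesh

variable (T : Mesh d)

lemma stress_eq_zero_of_stressSq {w : T.BrokenField} (h : T.stressSq w = 0) (K : T.elements)
    (i j : Fin d) : stress (w K) i j = 0 := by
  have h1 := (Finset.sum_eq_zero_iff_of_nonneg fun K _ => integral_nonneg fun _ =>
    Finset.sum_nonneg fun _ _ => Finset.sum_nonneg fun _ _ => sq_nonneg _).1 h K
      (Finset.mem_univ K)
  refine evalAt_eq_zero_of_integral_sq (T.isPolytope_element K).isCompact (T.isPolytope_element K).2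
    (le_antisymm (h1 ▸ ?_) (integral_nonneg fun x => sq_nonneg _))
  refine integral_mono (T.integrable_element K (by fun_prop))
    (T.integrable_element K (by fun_prop)) fun x => ?_
  refine le_trans ?_ (Finset.single_le_sum (f := fun i => ∑ j, evalAt x (stress (w K) i j) ^ 2)
    (fun i _ => Finset.sum_nonneg fun j _ => sq_nonneg _) (Finset.mem_univ i))
  exact Finset.single_le_sum (f := fun j => evalAt x (stress (w K) i j) ^ 2)
    (fun j _ => sq_nonneg _) (Finset.mem_univ j)

/-- Almost everywhere suffices: `eq_zero_on_hyperplane` upgrades this to the whole hyperplane. -/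
lemma ae_jump_eq_zero_of_jumpSq (hd : 2 ≤ d) {w : T.BrokenField} (h : T.jumpSq w = 0)
    (F : T.faces) (i : Fin d) :
    Measure.euclideanHausdorffMeasure (d - 1) {x ∈ F.1 | T.jump w F x i ≠ 0} = 0 := by
  have hpos : 0 < 1 / T.faceDiam F := one_div_pos.2 (T.faceDiam_pos hd F)
  have hnn (F : T.faces) (x : Pt d) : 0 ≤ 1 / T.faceDiam F * ∑ i, T.jump w F x i ^ 2 :=
    mul_nonneg (one_div_nonneg.2 Metric.diam_nonneg) (Finset.sum_nonneg fun _ _ => sq_nonneg _)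
  have h1 := (Finset.sum_eq_zero_iff_of_nonneg fun F _ => T.faceIntegral_nonneg F (hnn F)).1 h F
    (Finset.mem_univ F)
  have h2 := (setIntegral_eq_zero_iff_of_nonneg_ae (Filter.Eventually.of_forall (hnn F))
    (T.integrable_face F (by fun_prop))).1 h1
  rw [Filter.EventuallyEq, ae_restrict_iff'
    ((T.isFacet_plus F).isCompact (T.isPolytope_plus F)).measurableSet, ae_iff] at h2
  refine measure_mono_null (fun x hx => ?_) h2
  simp only [mem_ofPred_eq, Classical.not_imp]
  refine ⟨hx.1, ?_⟩
  have : 0 < ∑ i, T.jump w F x i ^ 2 :=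
    Finset.sum_pos' (fun _ _ => sq_nonneg _) ⟨i, Finset.mem_univ i, by have := hx.2; positivity⟩
  exact (mul_pos hpos this).ne'

lemma inner_normal_eq (F : T.faces) {x y : Pt d} (hx : x ∈ F.1) (hy : y ∈ F.1) :
    ⟪T.normal F, x⟫ = ⟪T.normal F, y⟫ := by
  have h := T.normal_outward F
  have hx' : x ∈ {x | x ∈ (T.plus F).1 ∧ ∀ y ∈ (T.plus F).1, ⟪T.normal F, y⟫ ≤ ⟪T.normal F, x⟫} :=
    h ▸ hx
  have hy' : y ∈ {x | x ∈ (T.plus F).1 ∧ ∀ y ∈ (T.plus F).1, ⟪T.normal F, y⟫ ≤ ⟪T.normal F, x⟫} :=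
    h ▸ hy
  exact le_antisymm (hy'.2 x hx'.1) (hx'.2 y hy'.1)

/-- If only one of the elements adjacent to a face carries a nonzero field, the jump is, up to
sign, the value of that field. -/
lemma evalAt_eq_zero_of_jump {w : T.BrokenField} {F : T.faces} {K : T.elements}
    (hK : IsFacet K.1 F.1) (h : ∀ K' : T.elements, IsFacet K'.1 F.1 → K' ≠ K → w K' = 0)
    {x : Pt d} {i : Fin d} (hj : T.jump w F x i = 0) : evalAt x (w K i) = 0 := by
  classical
  have hz : ∀ K' : T.elements, IsFacet K'.1 F.1 → K' ≠ K → evalAt x (w K' i) = 0 :=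
    fun K' h1 h2 => by rw [h K' h1 h2]; simp
  have hadj : ∀ K' : T.elements, K' ∈ T.adj F ↔ IsFacet K'.1 F.1 := fun K' => by simp [adj]
  unfold jump at hj
  by_cases hp : T.plus F = K
  · rw [Finset.sum_eq_zero, sub_zero] at hj
    · rwa [hp] at hj
    · intro K' hK'
      rw [Finset.mem_erase] at hK'
      exact hz K' ((hadj K').1 hK'.2) (hp ▸ hK'.1)
  · rw [hz _ (T.isFacet_plus F) hp, zero_sub, neg_eq_zero, Finset.sum_eq_single K] at hj
    · exact hj
    · intro K' hK' hne
      exact hz K' ((hadj K').1 (Finset.mem_of_mem_erase hK')) hne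
    · intro hnot
      exact absurd (Finset.mem_erase.2 ⟨Ne.symm hp, (hadj K).2 hK⟩) hnot

lemma eq_zero_of_normSymSup_eq_zero (hd : 2 ≤ d) (hd3 : d ≤ 3) {w : T.BrokenField}
    (h : T.normSymSup w = 0) : w = 0 := by
  classical
  have hd3' : (0 : ℝ) ≤ 3 - d := by
    have : (d : ℝ) ≤ 3 := by exact_mod_cast hd3
    linarith
  have hsq := T.normSymSup_sq hd3 w
  rw [h, zero_pow two_ne_zero] at hsq
  have h1 := T.stressSq_nonneg w
  have h2 := T.jumpSq_nonneg w
  have h3 : 0 ≤ 4 / 9 * (3 - (d : ℝ)) * T.divSq w := by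
    have := T.divSq_nonneg w
    positivity
  have hstress := T.stress_eq_zero_of_stressSq (w := w) (by linarith)
  have hjump := T.ae_jump_eq_zero_of_jumpSq hd (w := w) (by linarith)
  by_contra hw
  obtain ⟨K₀, hK₀⟩ := Function.ne_iff.1 hw
  -- The support of `w`. On a facet owned by only one of its elements, the jump is that element's
  -- field up to sign.
  let S : Finset (Set (Pt d)) := (Finset.univ.filter fun K : T.elements => w K ≠ 0).image (·.1)
  have hS : ∀ K : T.elements, K.1 ∈ S ↔ w K ≠ 0 := by
    intro K
    simp only [S, Finset.mem_image, Finset.mem_filter, Finset.mem_univ, true_and]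
    exact ⟨fun ⟨K', hK', he⟩ => Subtype.ext he ▸ hK', fun h => ⟨K, h, rfl⟩⟩
  have hST : ∀ K ∈ S, K ∈ T.elements := by
    intro K hK
    obtain ⟨K', -, rfl⟩ := Finset.mem_image.1 hK
    exact K'.2
  obtain ⟨K, hK, F, hF, hsingle⟩ := exists_facet_of_single (S := S) (by omega) ⟨K₀.1, (hS K₀).2 hK₀⟩
    (fun K hK => T.isPolytope K (hST K hK))
    (fun K hK K' hK' => T.disjoint_interior K (hST K hK) K' (hST K' hK'))
  let F' : T.faces := ⟨F, (T.mem_faces F).2 ⟨K, hST K hK, hF⟩⟩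
  let K' : T.elements := ⟨K, hST K hK⟩
  have hother : ∀ K'' : T.elements, IsFacet K''.1 F'.1 → K'' ≠ K' → w K'' = 0 := by
    intro K'' hF'' hne
    by_contra hne0
    exact hne (Subtype.ext (hsingle K''.1 ((hS K'').2 hne0) hF''))
  have hn := T.norm_normal F'
  have hn0 : T.normal F' ≠ 0 := fun h0 => by rw [h0, norm_zero] at hn; exact zero_ne_one hn
  obtain ⟨x₀, hx₀⟩ := (hF.nontrivial hd).nonempty
  refine (hS K').1 hK (eq_zero_of_stress_eq_zero (hstress K') hn (x₀ := x₀) fun v hv i => ?_)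
  refine eq_zero_on_hyperplane (g := fun x => evalAt x (w K' i)) hF.2
    (hF.convex (T.isPolytope K (hST K hK))) hn0
    (fun x hx y hy => T.inner_normal_eq F' hx hy) (analyticOnNhd_evalAt (w K' i) univ) ?_ hx₀ hv
  refine measure_mono_null (fun x hx => ?_) (hjump F' i)
  refine ⟨hx.1, fun h0 => hx.2 ?_⟩
  exact T.evalAt_eq_zero_of_jump hF hother h0

lemma isNormOn_normSymSup (hd : 2 ≤ d) (hd3 : d ≤ 3) (W : Submodule ℝ T.BrokenField) :
    IsNormOn W T.normSymSup :=
  ⟨fun _ _ => Real.sqrt_nonneg _, fun _ _ h => T.eq_zero_of_normSymSup_eq_zero hd hd3 h,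
    fun a w _ => T.normSymSup_smul a w, fun v _ w _ => T.normSymSup_add_le hd3 v w⟩

end Mesh

end Definiteness

end ViscousDG

theorem mainTheorem3 (d : ℕ) (hd : d = 2 ∨ d = 3) (m : ℕ) :
    -- `C_tr` is bounded in terms of the shape parameter of the mesh (and of `d`, `m`) only
    (∀ σ : ℝ, ∃ c : ℝ, ∀ T : ViscousDG.Mesh d, T.ShapeRegular σ → T.traceConst m ≤ c) ∧
    -- coercivity, with a constant that does not depend on the mesh
    (∀ (c : ℝ) (N : ℕ) (η : ℝ), 2 * c ^ 2 * (N : ℝ) < η →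
      ∃ C : ℝ, 0 < C ∧
        ∀ T : ViscousDG.Mesh d, T.traceConst m ≤ c → T.maxFaces ≤ N →
          ∀ W : Submodule ℝ T.BrokenField, T.IsVelocitySpace m W →
            ∀ w ∈ W, C * T.normSymSup w ^ 2 ≤ T.viscousForm η w w) ∧
    -- the stronger norm is a norm, and is the original one for `d = 3`
    (∀ (T : ViscousDG.Mesh d) (W : Submodule ℝ T.BrokenField), T.IsVelocitySpace m W →
      ViscousDG.IsNormOn W T.normSymSup ∧
      (d = 3 → ∀ w ∈ W, T.normSymSup w = T.normSym w)) := by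
  have hd2 : 2 ≤ d := by omega
  have hd3 : d ≤ 3 := by omega
  refine ⟨ViscousDG.Mesh.exists_traceConst_le hd2 m, fun c N η hη => ?_, fun T W _ =>
    ⟨T.isNormOn_normSymSup hd2 hd3 W, fun h w _ => ?_⟩⟩
  · obtain ⟨C, hC, H⟩ := ViscousDG.exists_coercivity_const hd m c N η hη
    exact ⟨C, hC, fun T hc hN W hW w hw => H T hc hN w (hW w hw).1⟩
  · subst h
    simp [ViscousDG.Mesh.normSymSup_eq, ViscousDG.Mesh.normSym_eq]
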